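/- A closed half-space in $\mathbb R^3$ is a set $\{x : \langle n,x\rangle + d\ge 0\}$ with $n\neq 0$. A convex polyhedron is a bounded subset $P\subset\mathbb R^3$ that does not lie in any plane and is an intersection of finitely many closed half-spaces. A vertex of $P$ is a point $v$ with $P\cap H=\{v\}$ for some closed half-space $H$; an edge (respectively a face) is a set $P\cap H$, with $H$ a closed half-space, that lies in a line but has more than one point (respectively lies in a plane but in no line). Let $\mathcal V$ and $\mathcal F$ be the sets of vertices and faces, $\mathcal I=\{(v,f)\in\mathcal V\times\mathcal F : v\in f\}$, and let $V,E,F$ be the numbers of vertices, edges and faces. A realization of $\Pi=(\mathcal V,\mathcal F,\mathcal I)$ assigns to each $v\in\mathcal V$ a point of $\mathbb R^3$ and to each $f\in\mathcal F$ a plane in $\mathbb R^3$, such that the point of $v$ lies on the plane of $f$ whenever $(v,f)\in\mathcal I$. The space of realizations is a subspace of $(\mathbb R^3)^{\mathcal V}\times\{\text{planes}\}^{\mathcal F}$, where the set of planes has the quotient topology from the coefficients $(n,c)$, $n\ne0$, of the equations $\langle n,x\rangle=c$. The polyhedron $P$ itself gives a realization, also denoted $P$: each vertex goes to itself and each face to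 the plane containing it. Let $$\phi:\mathbb R^{3V+3F}=(\mathbb R^3)^{\mathcal V}\times(\mathbb R^3)^{\mathcal F}\to\mathbb R^{\mathcal I},\qquad \phi_{v,f}\big((x_w)_{w\in\mathcal V},(a_g)_{g\in\mathcal F}\big)=\langle a_f,x_v\rangle-1 .$$ Given a point $o\in\mathbb R^3$, a realization none of whose planes contains $o$ has coordinates $((x_v),(a_f))\in\mathbb R^{3V+3F}$, where $x_v$ is the point of $v$ minus $o$, and the plane of $f$ is $\{x:\langle a_f,x-o\rangle=1\}$ (that is, coordinates after the translation that moves $o$ to the origin). **Lemma.** Let $P$ be a convex polyhedron. Then $V$, $E$ and $F$ are finite, and: 1. The elements of the disjoint union $\mathcal V\sqcup\mathcal F$ can be ordered so that each vertex or face is incident (in the sense of $\mathcal I$) with at most three earlier elements. 2. $|\mathcal I|=2E$ and $3V+3F-2E=E+6$. 3. Let $o\in\mathbb R^3$ be a point that lies on no plane containing a face of $P$, and take coordinates with origin $o$. Then the $2E$ differentials $D\phi_{v,f}(P)$, $(v,f)\in\mathcal I$, are linearly independent, and $D\phi(P)$ has rank $2E$. 4. For $o$ as in 3, the space of realizations of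 $\Pi$ is, in a neighborhood of $P$, a smooth manifold of dimension $E+6$, embedded by the coordinates as a smooth submanifold of $\mathbb R^{3V+3F}$. Precisely, there are an open neighborhood $U$ of $P$ in the space of realizations, consisting of realizations none of whose planes contains $o$, and a homeomorphism $e$ from $U$ onto an open subset of $\mathbb R^{E+6}$, such that the coordinate map $U\to\mathbb R^{3V+3F}$ is a topological embedding with image $W\cap\phi^{-1}(0)$ for some open $W\subset\mathbb R^{3V+3F}$, and its composition with $e^{-1}$ is $C^\infty$ with everywhere injective derivative. -/

import Mathlib

open scoped ContDiff

namespace ConvexPoly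

/-- Euclidean three-space. -/
abbrev E3 : Type := EuclideanSpace ℝ (Fin 3)

/-- A closed half-space of `ℝ³`: the solution set of `⟪n, x⟫ + d ≥ 0` with `n ≠ 0`. -/
def IsClosedHalfSpace (H : Set E3) : Prop :=
  ∃ n : E3, n ≠ 0 ∧ ∃ d : ℝ, H = {x | 0 ≤ inner ℝ n x + d}

/-- A plane in `ℝ³`. -/
@[ext]
structure Plane where
  carrier : Set E3
  isPlane : ∃ n : E3, n ≠ 0 ∧ ∃ c : ℝ, carrier = {x | inner ℝ n x = c}

/-- The plane `⟪n, x⟫ = c` with `n ≠ 0`. -/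
def Plane.ofEquation (p : {p : E3 × ℝ // p.1 ≠ 0}) : Plane where
  carrier := {x | inner ℝ p.1.1 x = p.1.2}
  isPlane := ⟨p.1.1, p.2, p.1.2, rfl⟩

/-- The natural topology on the set of planes: the quotient topology for the map that sends the
coefficients of an equation to the plane with this equation. -/
instance : TopologicalSpace Plane :=
  TopologicalSpace.coinduced Plane.ofEquation inferInstance

/-- A convex polyhedron: a bounded finite intersection of closed half-spaces that does not lie
in any plane. -/
def IsConvexPolyhedron (P : Set E3) : Prop :=
  Bornology.IsBounded P ∧ (¬ ∃ π : Plane, P ⊆ π.carrier) ∧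
    ∃ S : Set (Set E3), S.Finite ∧ (∀ H ∈ S, IsClosedHalfSpace H) ∧ P = ⋂₀ S

/-- The vertices: points `v` with `P ∩ H = {v}` for some closed half-space `H`. -/
def vertices (P : Set E3) : Set E3 :=
  {v | ∃ H, IsClosedHalfSpace H ∧ P ∩ H = {v}}

/-- The edges: sets of the form `P ∩ H`, with `H` a closed half-space, that lie within a line
but have more than one point. -/
def edges (P : Set E3) : Set (Set E3) :=
  {e | (∃ H, IsClosedHalfSpace H ∧ e = P ∩ H) ∧ Collinear ℝ e ∧ e.Nontrivial}

/-- The faces: sets of the form `P ∩ H`, with `H` a closed half-space, that lie within a plane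
but not within any line. -/
def faces (P : Set E3) : Set (Set E3) :=
  {f | (∃ H, IsClosedHalfSpace H ∧ f = P ∩ H) ∧ (∃ π : Plane, f ⊆ π.carrier) ∧
    ¬ Collinear ℝ f}

/-- The incidence relation of the underlying abstract polyhedron of `P`. -/
def Incident (P : Set E3) (v : vertices P) (f : faces P) : Prop :=
  (v : E3) ∈ (f : Set E3)

section Abstract

variable {V F : Type} (I : V → F → Prop)

/-- The pairs `(v, f)` that are related by an incidence relation. -/
abbrev Incidence : Type := {p : V × F // I p.1 p.2}

/-- The bipartite graph of an incidence relation: `v` and `f` are joined when they are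
incident, and there are no other edges. -/
def leviGraph : SimpleGraph (V ⊕ F) where
  Adj
    | .inl v, .inr f => I v f
    | .inr f, .inl v => I v f
    | _, _ => False
  symm := ⟨by rintro (v | f) (w | g) h <;> exact h⟩
  loopless := ⟨by rintro (v | f) h <;> exact h⟩

/-- A realization of an incidence structure: a point for each `v`, a plane for each `f`, the
point of `v` lying on the plane of `f` whenever `v` and `f` are incident. -/
structure Realization where
  point : V → E3
  plane : F → Plane
  incident : ∀ v f, I v f → point v ∈ (plane f).carrier

/-- The space of realizations is topologized as a subspace of `(ℝ³)^V × Planes^F`. -/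
instance : TopologicalSpace (Realization I) :=
  TopologicalSpace.induced (fun Q => (Q.point, Q.plane)) inferInstance

/-- The space `ℝ^(3V+3F)` of the coordinates `x_v, y_v, z_v` and `a_f, b_f, c_f`. -/
abbrev Coord (V F : Type) : Type := (V → E3) × (F → E3)

/-- The vertex-on-face functions `φ_{v,f} = a_f x_v + b_f y_v + c_f z_v - 1`, where `(v, f)`
runs over all incident pairs. -/
noncomputable def phi (x : Coord V F) : Incidence I → ℝ :=
  fun p => inner ℝ (x.2 p.1.2) (x.1 p.1.1) - 1

open Classical in
/-- For a plane `π` that misses the point `o`: the unique vector `a` such that `π` has the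
equation `⟪a, x - o⟫ = 1`. (A plane through `o` has no such equation, and gets the value `0`.) -/
noncomputable def planeCoeff (o : E3) (π : Plane) : E3 :=
  if h : ∃ a : E3, π.carrier = {x | inner ℝ a (x - o) = 1} then h.choose else 0

variable {I}

/-- The coordinates of a realization, after the translation that moves `o` to the origin. They
are meaningful for realizations none of whose planes passes through `o`. -/
noncomputable def coords (o : E3) (Q : Realization I) : Coord V F :=
  (fun v => Q.point v - o, fun f => planeCoeff o (Q.plane f))

/-- In a neighbourhood of the realization `Q`, the space of realizations is a smooth manifold of
dimension `d`, embedded by the coordinates (with origin `o`) as a smooth submanifold of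
`ℝ^(3V+3F)` which is locally the zero set of `φ`. Explicitly: there is a homeomorphism `e` from
an open neighbourhood of `Q` in the space of realizations to an open subset of `ℝ^d`; on this
neighbourhood, the coordinates are defined and are a topological embedding whose image is the
zero set of `φ` in some open set `W`; and the coordinates, as a function on the open subset of
`ℝ^d`, are smooth with everywhere injective derivative. -/
def IsSmoothManifoldNear [Fintype V] [Fintype F] (o : E3) (Q : Realization I) (d : ℕ) : Prop :=
  ∃ e : OpenPartialHomeomorph (Realization I) (EuclideanSpace ℝ (Fin d)),
    Q ∈ e.source ∧
    (∀ R ∈ e.source, ∀ f, o ∉ (R.plane f).carrier) ∧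
    Topology.IsEmbedding (e.source.domRestrict (coords o)) ∧
    (∃ W : Set (Coord V F), IsOpen W ∧ coords o '' e.source = {x ∈ W | phi I x = 0}) ∧
    ContDiffOn ℝ ∞ (fun y => coords o (e.symm y)) e.target ∧
    ∀ y ∈ e.target, Function.Injective (fderiv ℝ (fun y => coords o (e.symm y)) y)

end Abstract

/-- The plane that contains the face `f` (it is unique because `f` does not lie in a line). -/
noncomputable def facePlane (P : Set E3) (f : faces P) : Plane :=
  f.2.2.1.choose

/-- The polyhedron `P`, as a realization of its underlying abstract polyhedron. -/
noncomputable def selfRealization (P : Set E3) : Realization (Incident P) where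
  point v := v
  plane f := facePlane P f
  incident _ f h := f.2.2.1.choose_spec h

end ConvexPoly

open ConvexPoly

/-!
The polyhedron is written as the solution set of finitely many inequalities `0 ≤ ⟪nᵢ, x⟫ + dᵢ`, and
every face is described by the inequalities that are tight at one of its relatively interior points
(`HalfSpaceSystem.vertices_eq`, `edges_eq`, `faces_eq`). There are finitely many sets of
inequalities, so there are finitely many faces.

*Counting.* The local input is that a pointed two-dimensional polyhedral cone has exactly two sides
(`exists_two_generators`). It gives the diamond property `ncard_between`: an edge lies in two faces,
and a face has two edges at each of its vertices. As an edge has two vertices, counting the flags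
twice gives `|I| = 2E`. Applied to a horizontal section at the height of a vertex `v`, where the
height is a generic linear function, it says that `v` is neither the highest nor the lowest vertex
of exactly two of its faces, unless `v` is the highest or the lowest vertex of the polyhedron
(`ncard_middle`). Hence `|I| = 2F + 2(V - 2)`, and this with `|I| = 2E` is Euler's formula.

*Ordering.* The same height function orients the incidence graph with all out-degrees at most two:
a face points to its highest and lowest vertices, a vertex to the two faces in which it is neither.
In a set of elements in which all have four neighbours or more, each would have two out-neighbours;
but then one could climb from any vertex in the set, by paths of length two, to ever higher ones.
So every nonempty set contains an element with at most three neighbours in it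
(`Sweep.exists_degree_le_three`). No planarity of graphs is needed.

*Independence.* At most three vertices of a face have linearly independent position vectors, and at
most three faces at a vertex have linearly independent normals. In a linear relation between the
differentials, an element with at most three neighbours among those that occur can therefore not
occur (`linearIndependent_fderiv`).

*Manifold.* The realizations whose planes avoid `o` correspond through the coordinates to the zeros
of `φ` with all `a_f ≠ 0`, and the inverse function theorem straightens the zero set
(`exists_straightening`, `isSmoothManifoldNear_of_surjective`).
-/

namespace ConvexPoly

open Filter Topology Module

/-! ### Systems of inequalities and the faces of their solution sets -/

/-- A system of affine inequalities `0 ≤ ⟪nᵢ, x⟫ + dᵢ`, indexed by `ι`. The normals are allowed to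
vanish. -/
structure HalfSpaceSystem (ι E : Type*) where
  /-- The normal vectors `nᵢ`. -/
  normal : ι → E
  /-- The constant terms `dᵢ`. -/
  offset : ι → ℝ

namespace HalfSpaceSystem

variable {ι E : Type*} [NormedAddCommGroup E] [InnerProductSpace ℝ E] (S : HalfSpaceSystem ι E)

/-- The amount by which the point `x` satisfies the `i`-th inequality. -/
def slack (i : ι) (x : E) : ℝ := inner ℝ (S.normal i) x + S.offset i

/-- The solution set of the system. -/
def carrier : Set E := {x | ∀ i, 0 ≤ S.slack i x}

/-- The inequalities that are tight at `x`. -/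
def active (x : E) : Set ι := {i | S.slack i x = 0}

/-- The vectors orthogonal to all normals of inequalities that are tight at `x`. For `x` in the
solution set, this is the direction of the smallest face that contains `x`. -/
def dir (x : E) : Submodule ℝ E where
  carrier := {u | ∀ i ∈ S.active x, inner ℝ (S.normal i) u = 0}
  add_mem' ha hb i hi := by rw [inner_add_right, ha i hi, hb i hi, add_zero]
  zero_mem' i _ := inner_zero_right _
  smul_mem' c u hu i hi := by rw [real_inner_smul_right, hu i hi, mul_zero]

/-- The smallest face of the solution set that contains the solution `x`. -/
def face (x : E) : Set E := {y | y ∈ S.carrier ∧ S.active x ⊆ S.active y}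

variable {S}

lemma mem_dir {x u : E} : u ∈ S.dir x ↔ ∀ i ∈ S.active x, inner ℝ (S.normal i) u = 0 := Iff.rfl

lemma mem_active {x : E} {i : ι} : i ∈ S.active x ↔ S.slack i x = 0 := Iff.rfl

lemma slack_add_smul (i : ι) (x u : E) (t : ℝ) :
    S.slack i (x + t • u) = S.slack i x + t * inner ℝ (S.normal i) u := by
  simp only [slack, inner_add_right, real_inner_smul_right]; ring

lemma inner_sub_eq (i : ι) (x y : E) :
    inner ℝ (S.normal i) (y - x) = S.slack i y - S.slack i x := by
  simp only [slack, inner_sub_right]; ring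

lemma continuous_slack (i : ι) : Continuous (S.slack i) := by
  unfold slack; fun_prop

lemma mem_face_self {x : E} (hx : x ∈ S.carrier) : x ∈ S.face x := ⟨hx, subset_rfl⟩

lemma face_subset_face_iff {x y : E} (hx : x ∈ S.carrier) :
    S.face x ⊆ S.face y ↔ S.active y ⊆ S.active x :=
  ⟨fun h => (h (mem_face_self hx)).2, fun h _ hz => ⟨hz.1, h.trans hz.2⟩⟩

lemma face_eq_face_iff {x y : E} (hx : x ∈ S.carrier) (hy : y ∈ S.carrier) :
    S.face x = S.face y ↔ S.active x = S.active y := by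
  rw [Set.Subset.antisymm_iff, Set.Subset.antisymm_iff, face_subset_face_iff hx,
    face_subset_face_iff hy, and_comm]

lemma dir_anti {x y : E} (h : S.active x ⊆ S.active y) : S.dir y ≤ S.dir x :=
  fun _ hu i hi => hu i (h hi)

lemma sub_mem_dir {x y : E} (h : S.active x ⊆ S.active y) : y - x ∈ S.dir x := by
  intro i hi
  rw [inner_sub_eq, mem_active.1 hi, mem_active.1 (h hi), sub_zero]

lemma inner_sub_nonneg {x y : E} (hy : y ∈ S.carrier) {i : ι} (hi : i ∈ S.active x) :
    0 ≤ inner ℝ (S.normal i) (y - x) := by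
  rw [inner_sub_eq, mem_active.1 hi, sub_zero]; exact hy i

/-- If `x` lies in the face of `y`, then the inequalities tight at `y` are those tight at `x`
whose normal is orthogonal to `y - x`. -/
lemma active_eq_of_subset {x y : E} (h : S.active y ⊆ S.active x) :
    S.active y = {i | i ∈ S.active x ∧ inner ℝ (S.normal i) (y - x) = 0} := by
  ext i
  constructor
  · intro hi
    refine ⟨h hi, ?_⟩
    rw [inner_sub_eq, mem_active.1 hi, mem_active.1 (h hi), sub_zero]
  · rintro ⟨hi, h0⟩
    rw [inner_sub_eq, mem_active.1 hi, sub_zero] at h0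
    exact h0

lemma isClosed_carrier : IsClosed S.carrier := by
  simp only [carrier, Set.ofPred_forall]
  exact isClosed_iInter fun i => isClosed_le continuous_const (continuous_slack i)

lemma isClosed_face (x : E) : IsClosed (S.face x) := by
  have : S.face x = S.carrier ∩ ⋂ i ∈ S.active x, {y | S.slack i y = 0} := by
    ext y; simp [face, Set.subset_def, mem_active]
  rw [this]
  exact isClosed_carrier.inter
    (isClosed_biInter fun i _ => isClosed_eq (continuous_slack i) continuous_const)

lemma convex_carrier : Convex ℝ S.carrier := by
  intro x hx y hy a b ha hb hab i
  have : S.slack i (a • x + b • y) = a * S.slack i x + b * S.slack i y := by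
    simp only [slack, inner_add_right, real_inner_smul_right]
    linear_combination (-S.offset i) * hab
  rw [this]
  have := hx i; have := hy i
  positivity

/-- A small step in a direction that no tight inequality forbids stays in the solution set, and
exactly the tight inequalities with normal orthogonal to the step stay tight. -/
lemma eventually_step [Finite ι] {x u : E} (hx : x ∈ S.carrier)
    (hu : ∀ i ∈ S.active x, 0 ≤ inner ℝ (S.normal i) u) :
    ∀ᶠ t : ℝ in 𝓝[>] 0, x + t • u ∈ S.carrier ∧
      S.active (x + t • u) = {i | i ∈ S.active x ∧ inner ℝ (S.normal i) u = 0} := by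
  have key : ∀ i, ∀ᶠ t : ℝ in 𝓝[>] 0, 0 ≤ S.slack i (x + t • u) ∧
      (S.slack i (x + t • u) = 0 ↔ i ∈ S.active x ∧ inner ℝ (S.normal i) u = 0) := by
    intro i
    by_cases hi : i ∈ S.active x
    · filter_upwards [self_mem_nhdsWithin] with t ht
      have ht : 0 < t := ht
      rw [slack_add_smul, mem_active.1 hi, zero_add]
      exact ⟨mul_nonneg ht.le (hu i hi), by simp [hi, ht.ne']⟩
    · have hpos : 0 < S.slack i x := lt_of_le_of_ne (hx i) (Ne.symm hi)
      have hc : Continuous fun t : ℝ => S.slack i (x + t • u) :=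
        (continuous_slack i).comp (by fun_prop)
      have : ∀ᶠ t : ℝ in 𝓝 0, 0 < S.slack i (x + t • u) :=
        continuousAt_const.eventually_lt hc.continuousAt (by simpa using hpos)
      filter_upwards [nhdsWithin_le_nhds this] with t ht
      exact ⟨ht.le, by simp [hi, ht.ne']⟩
  filter_upwards [eventually_all.2 key] with t ht
  exact ⟨fun i => (ht i).1, by ext i; exact (ht i).2⟩

lemma exists_step [Finite ι] {x u : E} (hx : x ∈ S.carrier)
    (hu : ∀ i ∈ S.active x, 0 ≤ inner ℝ (S.normal i) u) :
    ∃ t : ℝ, 0 < t ∧ x + t • u ∈ S.carrier ∧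
      S.active (x + t • u) = {i | i ∈ S.active x ∧ inner ℝ (S.normal i) u = 0} :=
  ((eventually_step hx hu).and self_mem_nhdsWithin).exists.imp fun _ h => ⟨h.2, h.1⟩

lemma exists_step_of_mem_dir [Finite ι] {x u : E} (hx : x ∈ S.carrier) (hu : u ∈ S.dir x) :
    ∃ t : ℝ, 0 < t ∧ x + t • u ∈ S.carrier ∧ S.active (x + t • u) = S.active x := by
  obtain ⟨t, ht, h1, h2⟩ := exists_step hx (fun i hi => (hu i hi).ge)
  exact ⟨t, ht, h1, h2.trans (by ext i; exact ⟨fun h => h.1, fun h => ⟨h, hu i h⟩⟩)⟩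

lemma vectorSpan_face [Finite ι] {x : E} (hx : x ∈ S.carrier) :
    vectorSpan ℝ (S.face x) = S.dir x := by
  apply le_antisymm
  · rw [vectorSpan_eq_span_vsub_set_right ℝ (mem_face_self hx), Submodule.span_le]
    rintro _ ⟨y, hy, rfl⟩
    exact sub_mem_dir hy.2
  · intro u hu
    obtain ⟨t, ht, h1, h2⟩ := exists_step_of_mem_dir hx hu
    have := vsub_mem_vectorSpan ℝ (s := S.face x) ⟨h1, h2.ge⟩ (mem_face_self hx)
    rw [vsub_eq_sub, add_sub_cancel_left] at this
    exact (Submodule.smul_mem_iff _ ht.ne').1 this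

/-- In a bounded solution set one can walk from `x` inside its face, along any given line, until
a further inequality becomes tight. -/
lemma exists_hit [Finite ι] [FiniteDimensional ℝ E] (hS : Bornology.IsBounded S.carrier)
    {x u : E} (hx : x ∈ S.carrier) (hu : u ∈ S.dir x) (hu0 : u ≠ 0) :
    ∃ t : ℝ, x + t • u ∈ S.face x ∧ u ∉ S.dir (x + t • u) := by
  set T : Set ℝ := {t | x + t • u ∈ S.carrier} with hT
  have hcl : IsClosed T := isClosed_carrier.preimage (by fun_prop)
  have hbd : Bornology.IsBounded T := by
    obtain ⟨R, hR⟩ := (isBounded_iff_forall_norm_le.1 hS)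
    refine isBounded_iff_forall_norm_le.2 ⟨(R + ‖x‖) / ‖u‖, fun t ht => ?_⟩
    rw [le_div_iff₀ (norm_pos_iff.2 hu0), ← norm_smul]
    have h1 := hR _ ht
    have h2 : t • u = (x + t • u) - x := by abel
    rw [h2]
    exact (norm_sub_le _ _).trans (by linarith)
  have hne : T.Nonempty := ⟨0, by simpa [hT] using hx⟩
  obtain ⟨t, ht, hmax⟩ := (Metric.isCompact_of_isClosed_isBounded hcl hbd).exists_isGreatest hne
  refine ⟨t, ⟨ht, fun i hi => ?_⟩, fun hmem => ?_⟩
  · rw [mem_active, slack_add_smul, mem_active.1 hi, hu i hi]; simp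
  · obtain ⟨s, hs, h1, -⟩ := exists_step_of_mem_dir ht hmem
    have : t + s ∈ T := by
      rw [add_assoc, ← add_smul] at h1; exact h1
    linarith [hmax this]

/-- A linear functional takes its maximum on a face at a vertex: among the maximizers, one for
which the face has the smallest dimension is a vertex. -/
lemma exists_vertex_max [Finite ι] [FiniteDimensional ℝ E] (hS : Bornology.IsBounded S.carrier)
    {y : E} (hy : y ∈ S.carrier) (h : E) :
    ∃ v ∈ S.face y, S.dir v = ⊥ ∧ ∀ z ∈ S.face y, (inner ℝ h z : ℝ) ≤ inner ℝ h v := by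
  have hcpt : IsCompact (S.face y) := Metric.isCompact_of_isClosed_isBounded (isClosed_face y)
    (hS.subset fun z hz => hz.1)
  obtain ⟨w, hw, hwmax⟩ := hcpt.exists_isMaxOn ⟨y, mem_face_self hy⟩
    (f := fun z => (inner ℝ h z : ℝ)) (by fun_prop)
  set M : Set E := {v | v ∈ S.face y ∧ ∀ z ∈ S.face y, (inner ℝ h z : ℝ) ≤ inner ℝ h v} with hM
  obtain ⟨v, hv, hmin⟩ := exists_minimalFor_of_wellFoundedLT (· ∈ M)
    (fun v => finrank ℝ (S.dir v)) ⟨w, hw, fun z hz => hwmax hz⟩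
  refine ⟨v, hv.1, ?_, hv.2⟩
  by_contra hbot
  obtain ⟨u, hu, hu0⟩ := Submodule.exists_mem_ne_zero_of_ne_bot hbot
  have hle : ∀ u' ∈ S.dir v, (inner ℝ h u' : ℝ) ≤ 0 := by
    intro u' hu'
    obtain ⟨s, hs, h1, h2⟩ := exists_step_of_mem_dir hv.1.1 hu'
    have := hv.2 _ ⟨h1, h2.symm ▸ hv.1.2⟩
    rw [inner_add_right, real_inner_smul_right] at this
    nlinarith
  have h0 : (inner ℝ h u : ℝ) = 0 := by
    have h1 := hle u hu
    have h2 := hle (-u) (neg_mem hu)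
    rw [inner_neg_right] at h2
    linarith
  obtain ⟨t, ht1, ht2⟩ := exists_hit hS hv.1.1 hu hu0
  have hmem : v + t • u ∈ M := by
    refine ⟨⟨ht1.1, hv.1.2.trans ht1.2⟩, fun z hz => ?_⟩
    rw [inner_add_right, real_inner_smul_right, h0, mul_zero, add_zero]
    exact hv.2 z hz
  have hlt : S.dir (v + t • u) < S.dir v :=
    lt_of_le_of_ne (dir_anti ht1.2) fun he => ht2 (he ▸ hu)
  have := Submodule.finrank_lt_finrank_of_lt hlt
  exact absurd (hmin hmem this.le) (not_le.2 this)

lemma exists_vertex_min [Finite ι] [FiniteDimensional ℝ E] (hS : Bornology.IsBounded S.carrier)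
    {y : E} (hy : y ∈ S.carrier) (h : E) :
    ∃ v ∈ S.face y, S.dir v = ⊥ ∧ ∀ z ∈ S.face y, (inner ℝ h v : ℝ) ≤ inner ℝ h z := by
  obtain ⟨v, hv, h1, h2⟩ := exists_vertex_max hS hy (-h)
  refine ⟨v, hv, h1, fun z hz => ?_⟩
  have := h2 z hz
  rw [inner_neg_left, inner_neg_left] at this
  linarith

/-- A functional that separates the vertices is not constant on a face with more than one point. -/
lemma exists_mem_dir_inner_ne_zero [Finite ι] [FiniteDimensional ℝ E]
    (hS : Bornology.IsBounded S.carrier) {y h : E} (hy : y ∈ S.carrier)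
    (hh : Set.InjOn (fun z => (inner ℝ h z : ℝ)) {v | v ∈ S.carrier ∧ S.dir v = ⊥})
    (hd : S.dir y ≠ ⊥) : ∃ u ∈ S.dir y, (inner ℝ h u : ℝ) ≠ 0 := by
  by_contra! hcon
  obtain ⟨u, hu, hu0⟩ := Submodule.exists_mem_ne_zero_of_ne_bot hd
  obtain ⟨v, hv, hv1, hv2⟩ := exists_vertex_max hS hy u
  obtain ⟨w, hw, hw1, hw2⟩ := exists_vertex_min hS hy u
  have hvw : v = w := by
    apply hh ⟨hv.1, hv1⟩ ⟨hw.1, hw1⟩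
    have h1 := hcon _ (sub_mem_dir hv.2)
    have h2 := hcon _ (sub_mem_dir hw.2)
    simp only [inner_sub_right] at h1 h2 ⊢
    linarith
  obtain ⟨t, ht, h1, h2⟩ := exists_step_of_mem_dir hy hu
  have h3 := hv2 _ ⟨h1, h2.ge⟩
  have h4 := hw2 _ (mem_face_self hy)
  rw [inner_add_right, real_inner_smul_right] at h3
  have h5 : 0 < inner ℝ u u := real_inner_self_pos.2 hu0
  subst hvw
  nlinarith [mul_pos ht h5]

/-- A convex set of solutions has a point at which only those inequalities are tight that are
tight on the whole set. -/
lemma exists_forall_active_subset [Finite ι] {G : Set E} (hG : Convex ℝ G) (hne : G.Nonempty)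
    (hGS : G ⊆ S.carrier) : ∃ x ∈ G, ∀ y ∈ G, S.active x ⊆ S.active y := by
  obtain ⟨x, hx, hmin⟩ := exists_minimalFor_of_wellFoundedLT (· ∈ G) S.active hne
  refine ⟨x, hx, fun y hy => ?_⟩
  set z := (1 / 2 : ℝ) • x + (1 / 2 : ℝ) • y with hz
  have hzG : z ∈ G := hG hx hy (by norm_num) (by norm_num) (by norm_num)
  have hact : ∀ i ∈ S.active z, i ∈ S.active x ∧ i ∈ S.active y := by
    intro i hi
    have h1 := hGS hx i
    have h2 := hGS hy i
    have h3 : S.slack i z = 0 := hi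
    have h4 : S.slack i z = 1 / 2 * S.slack i x + 1 / 2 * S.slack i y := by
      simp only [hz, slack, inner_add_right, real_inner_smul_right]; ring
    exact ⟨by rw [mem_active]; linarith, by rw [mem_active]; linarith⟩
  intro i hi
  exact (hact i (hmin hzG (fun j hj => (hact j hj).1) hi)).2

end HalfSpaceSystem

/-! ### Two-dimensional cones, the diamond property and horizontal sections -/

namespace HalfSpaceSystem

variable {ι E : Type*} [NormedAddCommGroup E] [InnerProductSpace ℝ E] {S : HalfSpaceSystem ι E}

/-- A polyhedral cone in `W`, cut out by functionals that are all positive at some vector, and of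
dimension two modulo its lineality space `L`, is generated modulo `L` by two vectors, one on each
of its two sides. -/
lemma exists_two_generators [FiniteDimensional ℝ E] (n : ι → E) {A : Finset ι}
    {W L : Submodule ℝ E} (hLW : L ≤ W) (hL : ∀ u ∈ W, u ∈ L ↔ ∀ i ∈ A, inner ℝ (n i) u = 0)
    (hdim : finrank ℝ W = finrank ℝ L + 2) {u₀ : E} (hu₀ : u₀ ∈ W)
    (hpos : ∀ i ∈ A, 0 < inner ℝ (n i) u₀) :
    ∃ u₁ ∈ W, ∃ u₂ ∈ W, (∀ i ∈ A, 0 ≤ inner ℝ (n i) u₁) ∧ (∀ i ∈ A, 0 ≤ inner ℝ (n i) u₂) ∧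
      (∃ j ∈ A, inner ℝ (n j) u₁ = 0 ∧ 0 < inner ℝ (n j) u₂) ∧
      (∃ k ∈ A, inner ℝ (n k) u₂ = 0 ∧ 0 < inner ℝ (n k) u₁) ∧
      ∀ u ∈ W, (∀ i ∈ A, 0 ≤ inner ℝ (n i) u) →
        ∃ a b : ℝ, 0 ≤ a ∧ 0 ≤ b ∧ u - (a • u₁ + b • u₂) ∈ L := by
  classical
  set m : E := ∑ i ∈ A, n i with hm
  have hmin : ∀ u, (inner ℝ m u : ℝ) = ∑ i ∈ A, inner ℝ (n i) u := fun u => by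
    rw [hm, sum_inner]
  have hA : A.Nonempty := by
    by_contra hA
    rw [Finset.not_nonempty_iff_eq_empty] at hA
    have : W ≤ L := fun u hu => (hL u hu).2 (by simp [hA])
    have := Submodule.finrank_mono this
    omega
  have hm0 : 0 < (inner ℝ m u₀ : ℝ) := by rw [hmin]; exact Finset.sum_pos hpos hA
  -- The hyperplane of `W` parallel to a compact slice of the cone is spanned by `L` and `w`.
  set K : Submodule ℝ E := W ⊓ (ℝ ∙ m)ᗮ with hK
  have hKmem : ∀ u, u ∈ K ↔ u ∈ W ∧ (inner ℝ m u : ℝ) = 0 := fun u => by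
    rw [hK, Submodule.mem_inf, Submodule.mem_orthogonal_singleton_iff_inner_right]
  have hLK : L ≤ K := fun u hu => by
    rw [hKmem, hmin]
    exact ⟨hLW hu, Finset.sum_eq_zero ((hL u (hLW hu)).1 hu)⟩
  have hu₀0 : u₀ ≠ 0 := by rintro rfl; simp at hm0
  have hdec : ∀ u ∈ W, u - (inner ℝ m u / inner ℝ m u₀ : ℝ) • u₀ ∈ K := fun u hu => by
    rw [hKmem, inner_sub_right, real_inner_smul_right, div_mul_cancel₀ _ hm0.ne', sub_self]
    exact ⟨W.sub_mem hu (W.smul_mem _ hu₀), rfl⟩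
  have hKW : K < W := lt_of_le_of_ne inf_le_left fun h => by
    have : u₀ ∈ K := h ▸ hu₀
    rw [hKmem] at this
    exact hm0.ne' this.2
  have hWK : W ≤ K ⊔ ℝ ∙ u₀ := fun u hu => by
    rw [← sub_add_cancel u ((inner ℝ m u / inner ℝ m u₀ : ℝ) • u₀)]
    exact Submodule.add_mem_sup (hdec u hu)
      (Submodule.smul_mem _ _ (Submodule.mem_span_singleton_self _))
  have hd1 := Submodule.finrank_lt_finrank_of_lt hKW
  have hd2 : finrank ℝ W ≤ finrank ℝ K + 1 :=
    (Submodule.finrank_mono hWK).trans ((Submodule.finrank_add_le_finrank_add_finrank _ _).trans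
      (Nat.add_le_add_left (finrank_span_singleton hu₀0).le _))
  have hLK' : L < K := lt_of_le_of_ne hLK fun h => by rw [h] at hdim; omega
  obtain ⟨w, hwK, hwL⟩ := SetLike.exists_of_lt hLK'
  have hKeq : L ⊔ ℝ ∙ w = K := by
    have hle : L ⊔ ℝ ∙ w ≤ K := sup_le hLK ((Submodule.span_singleton_le_iff_mem _ _).2 hwK)
    apply Submodule.eq_of_le_of_finrank_le hle
    have : L < L ⊔ ℝ ∙ w := lt_of_le_of_ne le_sup_left fun h => hwL (by
      rw [h]; exact Submodule.mem_sup_right (Submodule.mem_span_singleton_self _))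
    have := Submodule.finrank_lt_finrank_of_lt this
    omega
  have hwW : w ∈ W := hKW.le hwK
  have hsum : ∑ i ∈ A, (inner ℝ (n i) w : ℝ) = 0 := by rw [← hmin]; exact ((hKmem w).1 hwK).2
  obtain ⟨i₀, hi₀, hi₀'⟩ : ∃ i ∈ A, (inner ℝ (n i) w : ℝ) ≠ 0 := by
    by_contra! h
    exact hwL ((hL w hwW).2 h)
  -- The ends of the slice are the first points beyond `u₀` on a side, in the directions `±w`.
  have hend : ∀ w' : E, (∃ i ∈ A, (inner ℝ (n i) w' : ℝ) < 0) → ∃ t : ℝ, 0 < t ∧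
      (∀ i ∈ A, 0 ≤ inner ℝ (n i) (u₀ + t • w')) ∧
      ∃ j ∈ A, inner ℝ (n j) (u₀ + t • w') = 0 ∧ (inner ℝ (n j) w' : ℝ) < 0 := by
    intro w' hw'
    obtain ⟨i₁, hi₁, hi₁'⟩ := hw'
    obtain ⟨j, hj, hjmin⟩ := (A.filter fun i => (inner ℝ (n i) w' : ℝ) < 0).exists_min_image
      (fun i => (inner ℝ (n i) u₀ : ℝ) / -inner ℝ (n i) w') ⟨i₁, by simp [hi₁, hi₁']⟩
    rw [Finset.mem_filter] at hj
    have hj0 := hpos j hj.1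
    refine ⟨(inner ℝ (n j) u₀ : ℝ) / -inner ℝ (n j) w', div_pos hj0 (by linarith [hj.2]),
      fun i hi => ?_, j, hj.1, ?_, hj.2⟩
    · rw [inner_add_right, real_inner_smul_right]
      rcases lt_or_ge (inner ℝ (n i) w' : ℝ) 0 with h | h
      · have := hjmin i (by simp [hi, h])
        rw [le_div_iff₀ (by linarith)] at this
        linarith
      · have := (hpos i hi).le
        have : 0 < (inner ℝ (n j) u₀ : ℝ) / -inner ℝ (n j) w' := div_pos hj0 (by linarith [hj.2])
        positivity
    · rw [inner_add_right, real_inner_smul_right]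
      have := hj.2.ne
      field_simp
      ring
  obtain ⟨t₂, ht₂, hu₂, j₂, hj₂, hj₂0, hj₂'⟩ := hend w (by
    by_contra! h
    exact hi₀' ((Finset.sum_eq_zero_iff_of_nonneg h).1 hsum i₀ hi₀))
  obtain ⟨t₁, ht₁, hu₁, j₁, hj₁, hj₁0, hj₁'⟩ := hend (-w) (by
    by_contra! h
    have h' : ∀ i ∈ A, (inner ℝ (n i) w : ℝ) ≤ 0 := fun i hi => by
      have := h i hi
      rw [inner_neg_right] at this
      linarith
    exact hi₀' ((Finset.sum_eq_zero_iff_of_nonpos h').1 hsum i₀ hi₀))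
  have hp1 := hpos j₁ hj₁
  have hp2 := hpos j₂ hj₂
  simp only [inner_add_right, real_inner_smul_right, inner_neg_right] at hj₁0 hj₁' hj₂0
  refine ⟨u₀ + t₁ • -w, W.add_mem hu₀ (W.smul_mem _ (W.neg_mem hwW)), u₀ + t₂ • w,
    W.add_mem hu₀ (W.smul_mem _ hwW), hu₁, hu₂, ⟨j₁, hj₁, ?_, ?_⟩, ⟨j₂, hj₂, ?_, ?_⟩, ?_⟩
  · simp only [inner_add_right, real_inner_smul_right, inner_neg_right]; exact hj₁0
  · simp only [inner_add_right, real_inner_smul_right]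
    nlinarith
  · simp only [inner_add_right, real_inner_smul_right]; exact hj₂0
  · simp only [inner_add_right, real_inner_smul_right, inner_neg_right]
    nlinarith
  · intro u hu huA
    set c : ℝ := inner ℝ m u / inner ℝ m u₀ with hc
    have hc0 : 0 ≤ c := div_nonneg (by rw [hmin]; exact Finset.sum_nonneg huA) hm0.le
    have hmem := hdec u hu
    rw [← hKeq] at hmem
    obtain ⟨l, hl, w', hw', hlw⟩ := Submodule.mem_sup.1 hmem
    obtain ⟨t, rfl⟩ := Submodule.mem_span_singleton.1 hw'
    have hueq : u = c • u₀ + t • w + l := by rw [← sub_add_cancel u (c • u₀), ← hlw]; abel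
    have hl0 := (hL l (hLW hl)).1 hl
    have h1 := huA j₁ hj₁
    have h2 := huA j₂ hj₂
    rw [hueq] at h1 h2
    simp only [inner_add_right, real_inner_smul_right, hl0 _ hj₁, hl0 _ hj₂] at h1 h2
    have h1' : 0 ≤ c * t₁ + t := by nlinarith
    have h2' : 0 ≤ c * t₂ - t := by nlinarith
    have htt : 0 < t₁ + t₂ := by linarith
    refine ⟨(c * t₂ - t) / (t₁ + t₂), (c * t₁ + t) / (t₁ + t₂), by positivity, by positivity, ?_⟩
    have e1 : (c * t₂ - t) / (t₁ + t₂) + (c * t₁ + t) / (t₁ + t₂) = c := by field_simp; ring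
    have e2 : (c * t₂ - t) / (t₁ + t₂) * -t₁ + (c * t₁ + t) / (t₁ + t₂) * t₂ = t := by
      field_simp; ring
    convert hl using 1
    rw [hueq]
    nth_rewrite 1 [← e1]
    nth_rewrite 3 [← e2]
    module

/-- Nested faces of the same dimension agree. -/
lemma active_eq_of_finrank_eq [FiniteDimensional ℝ E] {x y z : E}
    (hyz : S.active y ⊆ S.active z) (hzx : S.active z ⊆ S.active x)
    (hd : finrank ℝ (S.dir y) = finrank ℝ (S.dir z)) : S.active y = S.active z := by
  refine hyz.antisymm fun i hi => ?_
  have he : S.dir z = S.dir y := Submodule.eq_of_le_of_finrank_eq (dir_anti hyz) hd.symm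
  have := sub_mem_dir (hyz.trans hzx)
  rw [← he] at this
  have h2 := this i hi
  rw [inner_sub_eq, mem_active.1 (hzx hi), zero_sub, neg_eq_zero] at h2
  exact h2

/-- The diamond property: between two nested faces whose dimensions differ by two there are
exactly two further faces. -/
lemma ncard_between [Finite ι] [FiniteDimensional ℝ E] {x y₀ : E} (hx : x ∈ S.carrier)
    (hy₀ : y₀ ∈ S.carrier) (hyx : S.active y₀ ⊆ S.active x)
    (hdim : finrank ℝ (S.dir y₀) = finrank ℝ (S.dir x) + 2) :
    {f | ∃ y ∈ S.carrier, f = S.face y ∧ S.active y₀ ⊆ S.active y ∧ S.active y ⊆ S.active x ∧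
      finrank ℝ (S.dir y) = finrank ℝ (S.dir x) + 1}.ncard = 2 := by
  classical
  set A : Finset ι := (Set.toFinite (S.active x \ S.active y₀)).toFinset with hA
  have hmemA : ∀ i, i ∈ A ↔ i ∈ S.active x ∧ i ∉ S.active y₀ := fun i => by simp [hA]
  obtain ⟨u₁, hu₁, u₂, hu₂, hp₁, hp₂, ⟨j, hj, hj₁, hj₂⟩, ⟨k, hk, hk₂, hk₁⟩, hgen⟩ :=
    exists_two_generators (A := A) S.normal (dir_anti hyx)
      (fun u hu => ⟨fun h i hi => h i ((hmemA i).1 hi).1, fun h i hi => by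
        by_cases hi0 : i ∈ S.active y₀
        · exact hu i hi0
        · exact h i ((hmemA i).2 ⟨hi, hi0⟩)⟩) hdim
      (u₀ := y₀ - x) (by rw [← neg_sub]; exact neg_mem (sub_mem_dir hyx))
      (fun i hi => by
        rw [inner_sub_eq, mem_active.1 ((hmemA i).1 hi).1, sub_zero]
        exact lt_of_le_of_ne (hy₀ i) (Ne.symm ((hmemA i).1 hi).2))
  have hfeas : ∀ u ∈ S.dir y₀, (∀ i ∈ A, 0 ≤ (inner ℝ (S.normal i) u : ℝ)) →
      ∀ i ∈ S.active x, 0 ≤ (inner ℝ (S.normal i) u : ℝ) := fun u hu h i hi => by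
    by_cases hi0 : i ∈ S.active y₀
    · exact (hu i hi0).ge
    · exact h i ((hmemA i).2 ⟨hi, hi0⟩)
  have hf₁ := hfeas u₁ hu₁ hp₁
  have hf₂ := hfeas u₂ hu₂ hp₂
  have hray : ∀ u ∈ S.dir y₀, ∀ u' ∈ S.dir y₀, (∀ i ∈ S.active x, 0 ≤ inner ℝ (S.normal i) u) →
      (∃ k ∈ A, 0 < (inner ℝ (S.normal k) u : ℝ)) →
      (∃ j ∈ A, inner ℝ (S.normal j) u = 0 ∧ 0 < (inner ℝ (S.normal j) u' : ℝ)) →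
      ∃ y ∈ S.carrier, S.active y = {i | i ∈ S.active x ∧ inner ℝ (S.normal i) u = 0} ∧
        S.active y₀ ⊆ S.active y ∧ S.active y ⊆ S.active x ∧
        finrank ℝ (S.dir y) = finrank ℝ (S.dir x) + 1 := by
    rintro u hu u' hu' hf ⟨k, hk, hk0⟩ ⟨j, hj, hj0, hj1⟩
    obtain ⟨t, ht, hy, hact⟩ := exists_step hx hf
    have h1 : S.active y₀ ⊆ S.active (x + t • u) := fun i hi => hact ▸ ⟨hyx hi, hu i hi⟩
    have h2 : S.active (x + t • u) ⊆ S.active x := fun i hi => by rw [hact] at hi; exact hi.1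
    refine ⟨x + t • u, hy, hact, h1, h2, ?_⟩
    have l1 : S.dir x < S.dir (x + t • u) := lt_of_le_of_ne (dir_anti h2) fun he => by
      have : u ∈ S.dir x := he ▸ fun i hi => by rw [hact] at hi; exact hi.2
      exact hk0.ne' (this k ((hmemA k).1 hk).1)
    have l2 : S.dir (x + t • u) < S.dir y₀ := lt_of_le_of_ne (dir_anti h1) fun he => by
      have : u' ∈ S.dir (x + t • u) := he ▸ hu'
      exact hj1.ne' (this j (hact ▸ ⟨((hmemA j).1 hj).1, hj0⟩))
    have := Submodule.finrank_lt_finrank_of_lt l1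
    have := Submodule.finrank_lt_finrank_of_lt l2
    omega
  obtain ⟨y₁, hy₁, ha₁, hb₁, hc₁, hd₁⟩ := hray u₁ hu₁ u₂ hu₂ hf₁ ⟨k, hk, hk₁⟩ ⟨j, hj, hj₁, hj₂⟩
  obtain ⟨y₂, hy₂, ha₂, hb₂, hc₂, hd₂⟩ := hray u₂ hu₂ u₁ hu₁ hf₂ ⟨j, hj, hj₂⟩ ⟨k, hk, hk₂, hk₁⟩
  have hne : S.face y₁ ≠ S.face y₂ := by
    rw [Ne, face_eq_face_iff hy₁ hy₂]
    intro he
    have : j ∈ S.active y₁ := ha₁ ▸ ⟨((hmemA j).1 hj).1, hj₁⟩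
    rw [he, ha₂] at this
    exact hj₂.ne' this.2
  refine Eq.trans (congrArg Set.ncard ?_) (Set.ncard_pair hne)
  ext f
  constructor
  · rintro ⟨y, hy, rfl, hb, hc, hd⟩
    have hu : y - x ∈ S.dir y₀ := by
      intro i hi
      rw [inner_sub_eq, mem_active.1 (hb hi), mem_active.1 (hyx hi), sub_zero]
    obtain ⟨a, b, ha, hb', hl⟩ := hgen _ hu fun i hi =>
      inner_sub_nonneg hy ((hmemA i).1 hi).1
    have hin : ∀ i ∈ S.active y, a * inner ℝ (S.normal i) u₁ = 0 ∧
        b * inner ℝ (S.normal i) u₂ = 0 := by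
      intro i hi
      have h1 := hl i (hc hi)
      rw [active_eq_of_subset hc] at hi
      rw [inner_sub_right, hi.2, zero_sub, neg_eq_zero, inner_add_right, real_inner_smul_right,
        real_inner_smul_right] at h1
      have h2 := mul_nonneg ha (hf₁ i hi.1)
      have h3 := mul_nonneg hb' (hf₂ i hi.1)
      constructor <;> linarith
    simp only [Set.mem_insert_iff, Set.mem_singleton_iff]
    rcases ha.eq_or_lt with rfl | ha
    · rcases hb'.eq_or_lt with rfl | hb'
      · exfalso
        have he : S.active y = S.active x := by
          rw [active_eq_of_subset hc]
          ext i
          refine ⟨fun h => h.1, fun h => ⟨h, ?_⟩⟩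
          have := hl i h
          simpa using this
        have : S.dir y = S.dir x := (dir_anti he.ge).antisymm (dir_anti he.le)
        rw [this] at hd
        omega
      · right
        rw [face_eq_face_iff hy hy₂]
        refine active_eq_of_finrank_eq (fun i hi => ?_) hc₂ (hd.trans hd₂.symm)
        rw [ha₂]
        exact ⟨hc hi, (mul_eq_zero.1 (hin i hi).2).resolve_left hb'.ne'⟩
    · left
      rw [face_eq_face_iff hy hy₁]
      refine active_eq_of_finrank_eq (fun i hi => ?_) hc₁ (hd.trans hd₁.symm)
      rw [ha₁]
      exact ⟨hc hi, (mul_eq_zero.1 (hin i hi).1).resolve_left ha.ne'⟩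
  · rintro (rfl | rfl)
    · exact ⟨y₁, hy₁, rfl, hb₁, hc₁, hd₁⟩
    · exact ⟨y₂, hy₂, rfl, hb₂, hc₂, hd₂⟩

/-- A face of dimension one has exactly two vertices. -/
lemma ncard_vertices_of_finrank_eq_one [Finite ι] [FiniteDimensional ℝ E]
    (hS : Bornology.IsBounded S.carrier) {x : E} (hx : x ∈ S.carrier)
    (hd : finrank ℝ (S.dir x) = 1) : {v | v ∈ S.face x ∧ S.dir v = ⊥}.ncard = 2 := by
  obtain ⟨⟨u, hu⟩, hu0, hspan⟩ := finrank_eq_one_iff'.1 hd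
  have hu0 : u ≠ 0 := fun h => hu0 (by ext; exact h)
  have huu : 0 < (inner ℝ u u : ℝ) := real_inner_self_pos.2 hu0
  have hline : ∀ y ∈ S.face x, ∀ z ∈ S.face x, ∃ c : ℝ, z - y = c • u := by
    intro y hy z hz
    have : z - y ∈ S.dir x := by
      rw [← sub_sub_sub_cancel_right z y x]
      exact sub_mem (sub_mem_dir hz.2) (sub_mem_dir hy.2)
    obtain ⟨c, hc⟩ := hspan ⟨_, this⟩
    exact ⟨c, by rw [← Subtype.coe_inj] at hc; exact hc.symm⟩
  obtain ⟨v, hv, hv1, hv2⟩ := exists_vertex_max hS hx u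
  obtain ⟨w, hw, hw1, hw2⟩ := exists_vertex_min hS hx u
  have hvw : v ≠ w := by
    rintro rfl
    obtain ⟨t, ht, h1, h2⟩ := exists_step_of_mem_dir hx hu
    have h3 := hv2 _ ⟨h1, h2.ge⟩
    have h4 := hw2 _ (mem_face_self hx)
    rw [inner_add_right, real_inner_smul_right] at h3
    nlinarith [mul_pos ht huu]
  refine Eq.trans (congrArg Set.ncard ?_) (Set.ncard_pair hvw)
  ext z
  constructor
  · rintro ⟨hz, hz1⟩
    obtain ⟨c, hc⟩ := hline z hz v hv
    obtain ⟨c', hc'⟩ := hline z hz w hw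
    have hc0 : 0 ≤ c := by
      have h1 : (inner ℝ u (v - z) : ℝ) = c * inner ℝ u u := by rw [hc, real_inner_smul_right]
      have h2 := hv2 z hz
      rw [inner_sub_right] at h1
      by_contra! h
      nlinarith
    have hc0' : c' ≤ 0 := by
      have h1 : (inner ℝ u (w - z) : ℝ) = c' * inner ℝ u u := by rw [hc', real_inner_smul_right]
      have h2 := hw2 z hz
      rw [inner_sub_right] at h1
      by_contra! h
      nlinarith
    simp only [Set.mem_insert_iff, Set.mem_singleton_iff]
    rcases hc0.eq_or_lt with rfl | hc0
    · left; rw [zero_smul, sub_eq_zero] at hc; exact hc.symm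
    rcases hc0'.eq_or_lt with rfl | hc0'
    · right; rw [zero_smul, sub_eq_zero] at hc'; exact hc'.symm
    exfalso
    have : u ∈ S.dir z := by
      intro i hi
      have h1 := inner_sub_nonneg hv.1 hi
      have h2 := inner_sub_nonneg hw.1 hi
      rw [hc, real_inner_smul_right] at h1
      rw [hc', real_inner_smul_right] at h2
      have := nonneg_of_mul_nonneg_right h1 hc0
      have := nonpos_of_mul_nonneg_right h2 hc0'
      linarith
    rw [hz1] at this
    exact hu0 this
  · rintro (rfl | rfl)
    exacts [⟨hv, hv1⟩, ⟨hw, hw1⟩]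

/-- Let `h` be a height that separates the vertices of a full-dimensional polytope in dimension
three, and let `v` be a vertex that is neither highest nor lowest. Then exactly two facets through
`v` have points both above and below `v`. They correspond to the two sides at `v` of the polygon
in which the polytope meets the horizontal plane through `v`. -/
lemma ncard_middle [Finite ι] [FiniteDimensional ℝ E] (hE : finrank ℝ E = 3)
    (hS : Bornology.IsBounded S.carrier) {p v h : E} (hp : p ∈ S.carrier) (hp0 : S.active p = ∅)
    (hh : Set.InjOn (fun z => (inner ℝ h z : ℝ)) {v | v ∈ S.carrier ∧ S.dir v = ⊥})
    (hv : v ∈ S.carrier) (hv0 : S.dir v = ⊥)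
    (habove : ∃ q ∈ S.carrier, (inner ℝ h v : ℝ) < inner ℝ h q)
    (hbelow : ∃ q ∈ S.carrier, (inner ℝ h q : ℝ) < inner ℝ h v) :
    {f | ∃ y ∈ S.carrier, f = S.face y ∧ S.active y ⊆ S.active v ∧ finrank ℝ (S.dir y) = 2 ∧
      (∃ q ∈ f, (inner ℝ h v : ℝ) < inner ℝ h q) ∧
      (∃ q ∈ f, (inner ℝ h q : ℝ) < inner ℝ h v)}.ncard = 2 := by
  classical
  have hh0 : h ≠ 0 := by
    rintro rfl
    obtain ⟨q, -, hq⟩ := habove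
    simp at hq
  set W : Submodule ℝ E := (ℝ ∙ h)ᗮ with hW
  have hmemW : ∀ u, u ∈ W ↔ (inner ℝ h u : ℝ) = 0 := fun u =>
    Submodule.mem_orthogonal_singleton_iff_inner_right
  have : Fact (finrank ℝ E = 2 + 1) := ⟨hE⟩
  have hWdim : finrank ℝ W = 2 := Submodule.finrank_orthogonal_span_singleton hh0
  set A : Finset ι := (Set.toFinite (S.active v)).toFinset with hA
  have hmemA : ∀ i, i ∈ A ↔ i ∈ S.active v := fun i => by simp [hA]
  have hpos : ∀ i ∈ S.active v, 0 < (inner ℝ (S.normal i) (p - v) : ℝ) := fun i hi =>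
    lt_of_le_of_ne (inner_sub_nonneg hp hi) fun h0 => by
      rw [inner_sub_eq, mem_active.1 hi, sub_zero] at h0
      have : i ∈ S.active p := h0.symm
      rw [hp0] at this
      exact this
  obtain ⟨r, hr, t, ht, hrt⟩ : ∃ r ∈ S.carrier, ∃ t : ℝ, 0 ≤ t ∧
      (inner ℝ h (p - v) : ℝ) + t * inner ℝ h (r - v) = 0 := by
    obtain ⟨q, hq, hqv⟩ := habove
    obtain ⟨q', hq', hqv'⟩ := hbelow
    rcases le_total (inner ℝ h (p - v) : ℝ) 0 with h0 | h0
    · have h1 : 0 < (inner ℝ h (q - v) : ℝ) := by rw [inner_sub_right]; linarith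
      refine ⟨q, hq, -inner ℝ h (p - v) / inner ℝ h (q - v), div_nonneg (by linarith) h1.le, ?_⟩
      rw [div_mul_cancel₀ _ h1.ne']; ring
    · have h1 : 0 < -(inner ℝ h (q' - v) : ℝ) := by rw [inner_sub_right]; linarith
      refine ⟨q', hq', inner ℝ h (p - v) / -inner ℝ h (q' - v), div_nonneg h0 h1.le, ?_⟩
      have h2 : (inner ℝ h (q' - v) : ℝ) ≠ 0 := by linarith
      field_simp
      ring
  obtain ⟨u₁, hu₁, u₂, hu₂, hp₁, hp₂, ⟨j, hj, hj₁, hj₂⟩, ⟨k, hk, hk₂, hk₁⟩, hgen⟩ :=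
    exists_two_generators (A := A) (W := W) (L := ⊥) S.normal bot_le
      (fun u hu => by
        rw [← hv0, mem_dir]
        simp only [hmemA]) (by simp [hWdim])
      (u₀ := (p - v) + t • (r - v))
      (by rw [hmemW, inner_add_right, real_inner_smul_right]; exact hrt)
      (fun i hi => by
        rw [hmemA] at hi
        rw [inner_add_right, real_inner_smul_right]
        have := hpos i hi
        have := inner_sub_nonneg hr hi
        positivity)
  simp only [hmemA] at hp₁ hp₂ hj hk hgen
  have hray : ∀ u ∈ W, (∀ i ∈ S.active v, 0 ≤ (inner ℝ (S.normal i) u : ℝ)) →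
      (∃ k ∈ S.active v, 0 < (inner ℝ (S.normal k) u : ℝ)) →
      (∃ j ∈ S.active v, (inner ℝ (S.normal j) u : ℝ) = 0) →
      ∃ y ∈ S.carrier, S.active y = {i | i ∈ S.active v ∧ inner ℝ (S.normal i) u = 0} ∧
        S.active y ⊆ S.active v ∧ finrank ℝ (S.dir y) = 2 ∧
        (∃ q ∈ S.face y, (inner ℝ h v : ℝ) < inner ℝ h q) ∧
        (∃ q ∈ S.face y, (inner ℝ h q : ℝ) < inner ℝ h v) := by
    rintro u hu hf ⟨k, hk, hk0⟩ ⟨j, hj, hj0⟩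
    obtain ⟨t, ht, hy, hact⟩ := exists_step hv hf
    set y := v + t • u with hydef
    have h2 : S.active y ⊆ S.active v := fun i hi => by rw [hact] at hi; exact hi.1
    have huy : u ∈ S.dir y := fun i hi => by rw [hact] at hi; exact hi.2
    have hu0 : u ≠ 0 := by rintro rfl; simp at hk0
    have hbot : S.dir y ≠ ⊥ := fun h0 => hu0 (by rw [h0] at huy; exact huy)
    obtain ⟨z, hz, hz0⟩ := exists_mem_dir_inner_ne_zero hS hy hh hbot
    have hhy : (inner ℝ h y : ℝ) = inner ℝ h v := by
      rw [hydef, inner_add_right, real_inner_smul_right, (hmemW u).1 hu]; ring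
    have hmove : ∀ z ∈ S.dir y, 0 < (inner ℝ h z : ℝ) →
        ∃ q ∈ S.face y, (inner ℝ h v : ℝ) < inner ℝ h q := by
      intro z hz hz0
      obtain ⟨s, hs, h3, h4⟩ := exists_step_of_mem_dir hy hz
      refine ⟨_, ⟨h3, h4.ge⟩, ?_⟩
      rw [inner_add_right, real_inner_smul_right, hhy]
      nlinarith [mul_pos hs hz0]
    have hmove' : ∀ z ∈ S.dir y, (inner ℝ h z : ℝ) < 0 →
        ∃ q ∈ S.face y, (inner ℝ h q : ℝ) < inner ℝ h v := by
      intro z hz hz0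
      obtain ⟨s, hs, h3, h4⟩ := exists_step_of_mem_dir hy hz
      refine ⟨_, ⟨h3, h4.ge⟩, ?_⟩
      rw [inner_add_right, real_inner_smul_right, hhy]
      nlinarith [mul_pos hs (neg_pos.2 hz0)]
    refine ⟨y, hy, hact, h2, ?_, ?_, ?_⟩
    · have hlt : S.dir y < ⊤ := lt_top_iff_ne_top.2 fun htop => by
        have : p - v ∈ S.dir y := htop ▸ Submodule.mem_top
        exact (hpos j hj).ne' (this j (hact ▸ ⟨hj, hj0⟩))
      have l1 := Submodule.finrank_lt hlt.ne
      have l2 : W ⊓ S.dir y < S.dir y := lt_of_le_of_ne inf_le_right fun he => by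
        rw [← he] at hz
        exact hz0 ((hmemW z).1 hz.1)
      have l3 : (⊥ : Submodule ℝ E) < W ⊓ S.dir y := lt_of_le_of_ne bot_le fun he => by
        have : u ∈ W ⊓ S.dir y := ⟨hu, huy⟩
        rw [← he] at this
        exact hu0 this
      have := Submodule.finrank_lt_finrank_of_lt l2
      have := Submodule.finrank_lt_finrank_of_lt l3
      omega
    · rcases lt_or_gt_of_ne hz0 with h0 | h0
      · exact hmove (-z) (neg_mem hz) (by rw [inner_neg_right]; linarith)
      · exact hmove z hz h0
    · rcases lt_or_gt_of_ne hz0 with h0 | h0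
      · exact hmove' z hz h0
      · exact hmove' (-z) (neg_mem hz) (by rw [inner_neg_right]; linarith)
  obtain ⟨y₁, hy₁, ha₁, hc₁, hd₁, he₁⟩ := hray u₁ hu₁ hp₁ ⟨k, hk, hk₁⟩ ⟨j, hj, hj₁⟩
  obtain ⟨y₂, hy₂, ha₂, hc₂, hd₂, he₂⟩ := hray u₂ hu₂ hp₂ ⟨j, hj, hj₂⟩ ⟨k, hk, hk₂⟩
  have hne : S.face y₁ ≠ S.face y₂ := by
    rw [Ne, face_eq_face_iff hy₁ hy₂]
    intro he
    have : j ∈ S.active y₁ := ha₁ ▸ ⟨hj, hj₁⟩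
    rw [he, ha₂] at this
    exact hj₂.ne' this.2
  refine Eq.trans (congrArg Set.ncard ?_) (Set.ncard_pair hne)
  ext f
  constructor
  · rintro ⟨y, hy, rfl, hc, hd, ⟨q, hq, hqv⟩, ⟨q', hq', hqv'⟩⟩
    -- The segment from `q` to `q'`, seen from `v`, crosses the horizontal plane.
    set s : ℝ := inner ℝ h v - inner ℝ h q' with hs
    set s' : ℝ := inner ℝ h q - inner ℝ h v with hs'
    have hs0 : 0 < s := by linarith
    have hs0' : 0 < s' := by linarith
    obtain ⟨a, b, ha, hb, hl⟩ := hgen (s • (q - v) + s' • (q' - v))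
      (by
        rw [hmemW, inner_add_right, real_inner_smul_right, real_inner_smul_right, inner_sub_right,
          inner_sub_right]
        ring)
      (fun i hi => by
        rw [inner_add_right, real_inner_smul_right, real_inner_smul_right]
        have := inner_sub_nonneg hq.1 hi
        have := inner_sub_nonneg hq'.1 hi
        positivity)
    rw [Submodule.mem_bot, sub_eq_zero] at hl
    have hin : ∀ i ∈ S.active y, a * inner ℝ (S.normal i) u₁ = 0 ∧
        b * inner ℝ (S.normal i) u₂ = 0 := by
      intro i hi
      have h1 := congrArg (fun z => (inner ℝ (S.normal i) z : ℝ)) hl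
      simp only [inner_add_right, real_inner_smul_right, inner_sub_eq, mem_active.1 (hc hi),
        mem_active.1 (hq.2 hi), mem_active.1 (hq'.2 hi)] at h1
      have h2 := mul_nonneg ha (hp₁ i (hc hi))
      have h3 := mul_nonneg hb (hp₂ i (hc hi))
      constructor <;> linarith
    simp only [Set.mem_insert_iff, Set.mem_singleton_iff]
    rcases ha.eq_or_lt with rfl | ha
    · rcases hb.eq_or_lt with rfl | hb
      · exfalso
        have : q - v ∈ S.dir v := fun i hi => by
          have h1 := congrArg (fun z => (inner ℝ (S.normal i) z : ℝ)) hl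
          simp only [inner_add_right, real_inner_smul_right, zero_mul, add_zero] at h1
          have h2 := inner_sub_nonneg hq.1 hi
          have h3 := mul_nonneg hs0'.le (inner_sub_nonneg hq'.1 hi)
          by_contra h4
          have h5 := mul_pos hs0 (lt_of_le_of_ne h2 (Ne.symm h4))
          linarith
        rw [hv0, Submodule.mem_bot, sub_eq_zero] at this
        rw [this] at hqv
        exact lt_irrefl _ hqv
      · right
        rw [face_eq_face_iff hy hy₂]
        refine active_eq_of_finrank_eq (fun i hi => ?_) hc₂ (hd.trans hd₂.symm)
        rw [ha₂]
        exact ⟨hc hi, (mul_eq_zero.1 (hin i hi).2).resolve_left hb.ne'⟩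
    · left
      rw [face_eq_face_iff hy hy₁]
      refine active_eq_of_finrank_eq (fun i hi => ?_) hc₁ (hd.trans hd₁.symm)
      rw [ha₁]
      exact ⟨hc hi, (mul_eq_zero.1 (hin i hi).1).resolve_left ha.ne'⟩
  · rintro (rfl | rfl)
    · exact ⟨y₁, hy₁, rfl, hc₁, hd₁, he₁⟩
    · exact ⟨y₂, hy₂, rfl, hc₂, hd₂, he₂⟩

end HalfSpaceSystem

/-! ### Exposed sets are the faces of a system -/

namespace HalfSpaceSystem

variable {ι E : Type*} [NormedAddCommGroup E] [InnerProductSpace ℝ E] {S : HalfSpaceSystem ι E}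

/-- A half-space that meets a full-dimensional polyhedron in a set of smaller dimension supports
it. -/
lemma nonpos_of_vectorSpan_ne_top [Finite ι] {p : E} (hp : p ∈ S.carrier) (hp0 : S.active p = ∅)
    {m : E} {c : ℝ} (hH : vectorSpan ℝ (S.carrier ∩ {x | 0 ≤ inner ℝ m x + c}) ≠ ⊤) :
    ∀ x ∈ S.carrier, (inner ℝ m x : ℝ) + c ≤ 0 := by
  intro x hx
  by_contra! hpos
  have hc : Continuous fun t : ℝ => (inner ℝ m (x + t • (p - x)) : ℝ) + c := by fun_prop
  have hev : ∀ᶠ t : ℝ in 𝓝 0, 0 < (inner ℝ m (x + t • (p - x)) : ℝ) + c :=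
    continuousAt_const.eventually_lt hc.continuousAt (by simpa using hpos)
  obtain ⟨t, ⟨hq, hact⟩, hq'⟩ := ((eventually_step hx
    (fun i hi => inner_sub_nonneg hp hi)).and (nhdsWithin_le_nhds hev)).exists
  set q := x + t • (p - x) with hqdef
  have hq0 : S.active q = ∅ := by
    rw [hact, Set.eq_empty_iff_forall_notMem]
    rintro i ⟨hi, hi'⟩
    rw [inner_sub_eq, mem_active.1 hi, sub_zero] at hi'
    have : i ∈ S.active p := hi'
    rw [hp0] at this
    exact this
  refine hH (eq_top_iff.2 fun u _ => ?_)
  have hc' : Continuous fun t : ℝ => (inner ℝ m (q + t • u) : ℝ) + c := by fun_prop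
  have hev' : ∀ᶠ t : ℝ in 𝓝 0, 0 < (inner ℝ m (q + t • u) : ℝ) + c :=
    continuousAt_const.eventually_lt hc'.continuousAt (by simpa using hq')
  obtain ⟨s, ⟨⟨h1, -⟩, h2⟩, h3⟩ := (((eventually_step (u := u) hq
    (fun i hi => by rw [hq0] at hi; exact hi.elim)).and (nhdsWithin_le_nhds hev')).and
      self_mem_nhdsWithin).exists
  have hs : 0 < s := h3
  have := vsub_mem_vectorSpan ℝ (s := S.carrier ∩ {x | 0 ≤ (inner ℝ m x : ℝ) + c})
    ⟨h1, h2.le⟩ ⟨hq, hq'.le⟩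
  rw [vsub_eq_sub, add_sub_cancel_left] at this
  exact (Submodule.smul_mem_iff _ hs.ne').1 this

/-- A nonempty exposed set is the face of any point at which as few inequalities as possible are
tight. -/
lemma exists_eq_face [Finite ι] {m : E} {c : ℝ}
    (hle : ∀ x ∈ S.carrier, (inner ℝ m x : ℝ) + c ≤ 0)
    (hne : (S.carrier ∩ {x | 0 ≤ inner ℝ m x + c}).Nonempty) :
    ∃ x ∈ S.carrier, S.carrier ∩ {x | 0 ≤ inner ℝ m x + c} = S.face x := by
  have hconv : Convex ℝ (S.carrier ∩ {x | 0 ≤ inner ℝ m x + c}) := by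
    refine convex_carrier.inter ?_
    intro x hx y hy a b ha hb hab
    have hx : 0 ≤ (inner ℝ m x : ℝ) + c := hx
    have hy : 0 ≤ (inner ℝ m y : ℝ) + c := hy
    have : (inner ℝ m (a • x + b • y) : ℝ) + c = a * (inner ℝ m x + c) + b * (inner ℝ m y + c) := by
      rw [inner_add_right, real_inner_smul_right, real_inner_smul_right]
      linear_combination (-c) * hab
    rw [Set.mem_ofPred_eq, this]
    positivity
  obtain ⟨x, hx, hmin⟩ := exists_forall_active_subset hconv hne Set.inter_subset_left
  refine ⟨x, hx.1, Set.Subset.antisymm (fun y hy => ⟨hy.1, hmin y hy⟩) fun y hy => ⟨hy.1, ?_⟩⟩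
  -- The segment from `y` can be prolonged beyond `x` within the solution set.
  have hxy : x - y ∈ S.dir x := by rw [← neg_sub]; exact neg_mem (sub_mem_dir hy.2)
  obtain ⟨t, ht, h1, -⟩ := exists_step_of_mem_dir hx.1 hxy
  have h2 := hle _ h1
  have h3 : 0 ≤ (inner ℝ m x : ℝ) + c := hx.2
  rw [inner_add_right, real_inner_smul_right, inner_sub_right] at h2
  have h4 := hle _ hx.1
  rw [Set.mem_ofPred_eq]
  by_contra! h5
  nlinarith [mul_pos ht (neg_pos.2 h5)]

/-- Conversely, every proper face is exposed, by the sum of the inequalities tight on it. -/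
lemma exists_supporting [Finite ι] {p x : E} (hp : p ∈ S.carrier) (hp0 : S.active p = ∅)
    (hne : (S.active x).Nonempty) :
    ∃ m : E, m ≠ 0 ∧ ∃ c : ℝ, (∀ y ∈ S.carrier, (inner ℝ m y : ℝ) + c ≤ 0) ∧
      (∀ y ∈ S.carrier, y ∈ S.face x ↔ (inner ℝ m y : ℝ) + c = 0) ∧
      S.face x = S.carrier ∩ {y | 0 ≤ inner ℝ m y + c} := by
  classical
  set A : Finset ι := (Set.toFinite (S.active x)).toFinset with hA
  have hmemA : ∀ i, i ∈ A ↔ i ∈ S.active x := fun i => by simp [hA]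
  have hsum : ∀ y, (inner ℝ (-∑ i ∈ A, S.normal i) y : ℝ) + -∑ i ∈ A, S.offset i
      = -∑ i ∈ A, S.slack i y := fun y => by
    simp only [slack, inner_neg_left, sum_inner, Finset.sum_add_distrib]; ring
  have hle : ∀ y ∈ S.carrier,
      (inner ℝ (-∑ i ∈ A, S.normal i) y : ℝ) + -∑ i ∈ A, S.offset i ≤ 0 := fun y hy => by
    rw [hsum, neg_nonpos]; exact Finset.sum_nonneg fun i _ => hy i
  have hiff : ∀ y ∈ S.carrier, y ∈ S.face x ↔
      (inner ℝ (-∑ i ∈ A, S.normal i) y : ℝ) + -∑ i ∈ A, S.offset i = 0 := fun y hy => by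
    rw [hsum, neg_eq_zero, Finset.sum_eq_zero_iff_of_nonneg fun i _ => hy i]
    simp only [hmemA]
    exact ⟨fun h => h.2, fun h => ⟨hy, h⟩⟩
  refine ⟨-∑ i ∈ A, S.normal i, fun h0 => ?_, -∑ i ∈ A, S.offset i, hle, hiff, ?_⟩
  · have h1 := hsum p
    have h2 := hsum x
    rw [h0, inner_zero_left] at h1 h2
    have h3 : ∑ i ∈ A, S.slack i x = 0 := Finset.sum_eq_zero fun i hi => (hmemA i).1 hi
    have h4 : 0 < ∑ i ∈ A, S.slack i p := by
      refine Finset.sum_pos (fun i _ => lt_of_le_of_ne (hp i) fun h => ?_)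
        (hne.imp fun i hi => (hmemA i).2 hi)
      have : i ∈ S.active p := h.symm
      rw [hp0] at this
      exact this
    linarith
  · ext y
    constructor
    · exact fun hy => ⟨hy.1, ((hiff y hy.1).1 hy).ge⟩
    · exact fun hy => (hiff y hy.1).2 ((hle y hy.1).antisymm hy.2)

lemma dir_eq_top_of_active_eq_empty {x : E} (h : S.active x = ∅) : S.dir x = ⊤ :=
  eq_top_iff.2 fun u _ i hi => by rw [h] at hi; exact hi.elim

lemma active_nonempty_of_dir_ne_top {x : E} (h : S.dir x ≠ ⊤) : (S.active x).Nonempty := by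
  by_contra h0
  exact h (dir_eq_top_of_active_eq_empty (Set.not_nonempty_iff_eq_empty.1 h0))

end HalfSpaceSystem

open HalfSpaceSystem

lemma vectorSpan_ne_top_of_subset_plane {s : Set E3} {π : Plane} (h : s ⊆ π.carrier) :
    vectorSpan ℝ s ≠ ⊤ := by
  obtain ⟨n, hn, c, hc⟩ := π.isPlane
  intro htop
  have hle : vectorSpan ℝ s ≤ (ℝ ∙ n)ᗮ := by
    rw [vectorSpan, Submodule.span_le]
    rintro _ ⟨x, hx, y, hy, rfl⟩
    have hx' := h hx
    have hy' := h hy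
    rw [hc] at hx' hy'
    have hx' : (inner ℝ n x : ℝ) = c := hx'
    have hy' : (inner ℝ n y : ℝ) = c := hy'
    rw [SetLike.mem_coe, Submodule.mem_orthogonal_singleton_iff_inner_right]
    simp [inner_sub_right, hx', hy']
  rw [htop, top_le_iff] at hle
  have : n ∈ (ℝ ∙ n)ᗮ := hle ▸ Submodule.mem_top
  rw [Submodule.mem_orthogonal_singleton_iff_inner_right, inner_self_eq_zero] at this
  exact hn this

lemma finrank_E3 : finrank ℝ E3 = 3 := by simp

lemma ne_top_of_finrank_le {K : Submodule ℝ E3} (h : finrank ℝ K ≤ 2) : K ≠ ⊤ := by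
  rintro rfl
  rw [finrank_top, finrank_E3] at h
  omega

lemma vectorSpan_ne_top_of_collinear {s : Set E3} (h : Collinear ℝ s) : vectorSpan ℝ s ≠ ⊤ := by
  rw [collinear_iff_finrank_le_one] at h
  intro htop
  rw [htop, finrank_top, finrank_E3] at h
  omega

/-- A convex polyhedron is the solution set of a finite system of inequalities, and has a point
at which none of them is tight. -/
lemma IsConvexPolyhedron.exists_system {P : Set E3} (hP : IsConvexPolyhedron P) :
    ∃ (ι : Type) (_ : Finite ι) (S : HalfSpaceSystem ι E3), P = S.carrier ∧
      Bornology.IsBounded S.carrier ∧ ∃ p ∈ S.carrier, S.active p = ∅ := by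
  obtain ⟨hbd, hplane, T, hT, hTH, hPT⟩ := hP
  choose! n hn d hd using hTH
  let S : HalfSpaceSystem T E3 := ⟨fun H => n H.1, fun H => d H.1⟩
  have hPS : P = S.carrier := by
    rw [hPT]
    ext x
    simp only [Set.mem_sInter]
    constructor
    · intro h H
      have h1 := h H.1 H.2
      rw [hd H.1 H.2] at h1
      exact h1
    · intro h H hH
      have h1 := h ⟨H, hH⟩
      rw [hd H hH]
      exact h1
  have : Finite T := hT
  refine ⟨T, inferInstance, S, hPS, hPS ▸ hbd, ?_⟩
  have hne : S.carrier.Nonempty := by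
    rw [← hPS]
    by_contra h0
    rw [Set.not_nonempty_iff_eq_empty] at h0
    obtain ⟨e, he⟩ := exists_ne (0 : E3)
    exact hplane ⟨Plane.ofEquation ⟨(e, 0), he⟩, by simp [h0]⟩
  obtain ⟨p, hp, hmin⟩ := exists_forall_active_subset S.convex_carrier hne subset_rfl
  refine ⟨p, hp, Set.eq_empty_iff_forall_notMem.2 fun i hi => ?_⟩
  refine hplane ⟨Plane.ofEquation ⟨(n i.1, -d i.1), hn i.1 i.2⟩, fun y hy => ?_⟩
  rw [hPS] at hy
  have h1 : inner ℝ (n i.1) y + d i.1 = 0 := hmin y hy hi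
  change inner ℝ (n i.1) y = -d i.1
  linarith

namespace HalfSpaceSystem

variable {ι : Type*} {S : HalfSpaceSystem ι E3}

lemma face_eq_singleton {x : E3} (hx : x ∈ S.carrier) (hd : S.dir x = ⊥) : S.face x = {x} := by
  ext y
  refine ⟨fun hy => ?_, by rintro rfl; exact mem_face_self hx⟩
  have := sub_mem_dir hy.2
  rw [hd, Submodule.mem_bot, sub_eq_zero] at this
  exact this

variable [Finite ι]

lemma exists_eq_face_of_halfSpace {p : E3} (hp : p ∈ S.carrier) (hp0 : S.active p = ∅)
    {H : Set E3} (hH : IsClosedHalfSpace H) (hne : (S.carrier ∩ H).Nonempty)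
    (hspan : vectorSpan ℝ (S.carrier ∩ H) ≠ ⊤) : ∃ x ∈ S.carrier, S.carrier ∩ H = S.face x := by
  obtain ⟨m, -, c, rfl⟩ := hH
  exact exists_eq_face (nonpos_of_vectorSpan_ne_top hp hp0 hspan) hne

lemma exists_halfSpace {p x : E3} (hp : p ∈ S.carrier) (hp0 : S.active p = ∅)
    (hd : S.dir x ≠ ⊤) :
    ∃ H, IsClosedHalfSpace H ∧ S.face x = S.carrier ∩ H := by
  obtain ⟨m, hm, c, -, -, h⟩ := exists_supporting hp hp0 (active_nonempty_of_dir_ne_top hd)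
  exact ⟨_, ⟨m, hm, c, rfl⟩, h⟩

lemma vertices_eq {p : E3} (hp : p ∈ S.carrier) (hp0 : S.active p = ∅) :
    vertices S.carrier = {x | x ∈ S.carrier ∧ S.dir x = ⊥} := by
  ext v
  constructor
  · rintro ⟨H, hH, hv⟩
    obtain ⟨x, hx, hxf⟩ := exists_eq_face_of_halfSpace hp hp0 hH (by simp [hv]) (by
      rw [hv, vectorSpan_singleton]; exact ne_top_of_finrank_le (by simp))
    rw [hv] at hxf
    have hxv : x ∈ ({v} : Set E3) := hxf ▸ mem_face_self hx
    obtain rfl : x = v := hxv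
    refine ⟨hx, ?_⟩
    rw [← vectorSpan_face hx, ← hxf, vectorSpan_singleton]
  · rintro ⟨hv, hd⟩
    obtain ⟨H, hH, h⟩ := exists_halfSpace (x := v) hp hp0 (by rw [hd]; exact bot_ne_top)
    exact ⟨H, hH, by rw [← h, face_eq_singleton hv hd]⟩

lemma collinear_face_iff {x : E3} (hx : x ∈ S.carrier) :
    Collinear ℝ (S.face x) ↔ finrank ℝ (S.dir x) ≤ 1 := by
  rw [collinear_iff_finrank_le_one, vectorSpan_face hx]

lemma nontrivial_face_iff {x : E3} (hx : x ∈ S.carrier) :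
    (S.face x).Nontrivial ↔ S.dir x ≠ ⊥ := by
  rw [← vectorSpan_face hx, Ne, vectorSpan_eq_bot_iff_subsingleton, Set.not_subsingleton_iff]

lemma edges_eq {p : E3} (hp : p ∈ S.carrier) (hp0 : S.active p = ∅) :
    edges S.carrier = {f | ∃ x ∈ S.carrier, f = S.face x ∧ finrank ℝ (S.dir x) = 1} := by
  ext f
  constructor
  · rintro ⟨⟨H, hH, rfl⟩, hcol, hnt⟩
    obtain ⟨x, hx, hxf⟩ := exists_eq_face_of_halfSpace hp hp0 hH hnt.nonempty
      (vectorSpan_ne_top_of_collinear hcol)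
    refine ⟨x, hx, hxf, ?_⟩
    rw [hxf] at hcol hnt
    rw [collinear_face_iff hx] at hcol
    rw [nontrivial_face_iff hx, Ne, ← Submodule.finrank_eq_zero] at hnt
    omega
  · rintro ⟨x, hx, rfl, hd⟩
    refine ⟨?_, (collinear_face_iff hx).2 hd.le, (nontrivial_face_iff hx).2 fun h => ?_⟩
    · obtain ⟨H, hH, h⟩ := exists_halfSpace (x := x) hp hp0 (ne_top_of_finrank_le (by omega))
      exact ⟨H, hH, h⟩
    · rw [h, finrank_bot] at hd
      omega

lemma faces_eq {p : E3} (hp : p ∈ S.carrier) (hp0 : S.active p = ∅) :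
    faces S.carrier = {f | ∃ x ∈ S.carrier, f = S.face x ∧ finrank ℝ (S.dir x) = 2} := by
  ext f
  constructor
  · rintro ⟨⟨H, hH, rfl⟩, ⟨π, hπ⟩, hcol⟩
    have hne : (S.carrier ∩ H).Nonempty := by
      by_contra h0
      rw [Set.not_nonempty_iff_eq_empty] at h0
      rw [h0] at hcol
      exact hcol (collinear_empty ℝ E3)
    have hspan := vectorSpan_ne_top_of_subset_plane hπ
    obtain ⟨x, hx, hxf⟩ := exists_eq_face_of_halfSpace hp hp0 hH hne hspan
    refine ⟨x, hx, hxf, ?_⟩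
    rw [hxf] at hcol hspan
    rw [collinear_face_iff hx] at hcol
    rw [vectorSpan_face hx] at hspan
    have := Submodule.finrank_lt hspan
    rw [finrank_E3] at this
    omega
  · rintro ⟨x, hx, rfl, hd⟩
    refine ⟨?_, ?_, fun h => ?_⟩
    · obtain ⟨H, hH, h⟩ := exists_halfSpace (x := x) hp hp0 (ne_top_of_finrank_le (by omega))
      exact ⟨H, hH, h⟩
    · obtain ⟨m, hm, c, -, hiff, -⟩ := exists_supporting hp hp0
        (active_nonempty_of_dir_ne_top (ne_top_of_finrank_le hd.le))
      refine ⟨Plane.ofEquation ⟨(m, -c), hm⟩, fun y hy => ?_⟩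
      have := (hiff y hy.1).1 hy
      change inner ℝ m y = -c
      linarith
    · rw [collinear_face_iff hx] at h
      omega

lemma finite_faces (S : HalfSpaceSystem ι E3) : {f | ∃ x ∈ S.carrier, f = S.face x}.Finite := by
  refine ((Set.finite_univ (α := Set ι)).image fun A => {y | y ∈ S.carrier ∧ A ⊆ S.active y}).subset
    ?_
  rintro _ ⟨x, -, rfl⟩
  exact ⟨S.active x, trivial, rfl⟩

lemma finite_vertices (S : HalfSpaceSystem ι E3) : {x | x ∈ S.carrier ∧ S.dir x = ⊥}.Finite := by
  refine Set.Finite.of_finite_image (f := S.face) ((finite_faces S).subset ?_) ?_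
  · rintro _ ⟨x, hx, rfl⟩
    exact ⟨x, hx.1, rfl⟩
  · rintro x hx y hy hxy
    rw [face_eq_singleton hx.1 hx.2, face_eq_singleton hy.1 hy.2] at hxy
    exact Set.singleton_injective hxy

end HalfSpaceSystem

/-! ### Ordering and counting from incidence data -/

/-- If every nonempty set of vertices of a finite graph contains a vertex with at most `k`
neighbours in the set, then the vertices can be ordered such that each has at most `k` earlier
neighbours. -/
lemma exists_order_of_degenerate {α : Type*} [Fintype α] (G : SimpleGraph α) {k m : ℕ}
    (hm : Fintype.card α = m)
    (h : ∀ S : Finset α, S.Nonempty → ∃ s ∈ S, {t | t ∈ S ∧ G.Adj t s}.ncard ≤ k) :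
    ∃ n : Fin m ≃ α, ∀ i, {j | j < i ∧ G.Adj (n j) (n i)}.ncard ≤ k := by
  classical
  have key : ∀ c : ℕ, ∀ S : Finset α, S.card = c → ∃ r : α → ℕ, Set.InjOn r S ∧
      ∀ s ∈ S, {t | t ∈ S ∧ r t < r s ∧ G.Adj t s}.ncard ≤ k := by
    intro c
    induction c with
    | zero =>
      intro S hS
      rw [Finset.card_eq_zero] at hS
      subst hS
      exact ⟨fun _ => 0, by simp, by simp⟩
    | succ c ih =>
      intro S hS
      obtain ⟨s, hs, hsk⟩ := h S (by rw [← Finset.card_pos]; omega)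
      obtain ⟨r, hr, hrk⟩ := ih (S.erase s) (by rw [Finset.card_erase_of_mem hs]; omega)
      -- The vertex `s` goes behind all others.
      set b := (S.sup r) + 1 with hb
      have hlt : ∀ t ∈ S, r t < b := fun t ht => Nat.lt_succ_of_le (Finset.le_sup ht)
      have hother : ∀ t, t ≠ s → Function.update r s b t = r t := fun t ht =>
        Function.update_of_ne ht _ _
      have hself : Function.update r s b s = b := Function.update_self _ _ _
      refine ⟨Function.update r s b, fun t ht t' ht' htt => ?_, fun t ht => ?_⟩
      · by_cases h1 : t = s <;> by_cases h2 : t' = s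
        · rw [h1, h2]
        · rw [h1, hself, hother _ h2] at htt
          exact absurd htt (hlt t' ht').ne'
        · rw [h2, hself, hother _ h1] at htt
          exact absurd htt (hlt t ht).ne
        · rw [hother _ h1, hother _ h2] at htt
          exact hr (by simp [h1, Finset.mem_coe.1 ht]) (by simp [h2, Finset.mem_coe.1 ht']) htt
      · by_cases h1 : t = s
        · subst h1
          refine (Set.ncard_le_ncard ?_ (Set.toFinite _)).trans hsk
          rintro u ⟨hu1, -, hu3⟩
          exact ⟨hu1, hu3⟩
        · refine (Set.ncard_le_ncard (fun u hu => ?_) (Set.toFinite _)).trans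
            (hrk t (by simp [h1, ht]))
          obtain ⟨hu1, hu2, hu3⟩ := hu
          have h2 : u ≠ s := by
            rintro rfl
            rw [hself, hother _ h1] at hu2
            exact absurd hu2 (hlt t ht).le.not_gt
          rw [hother _ h1, hother _ h2] at hu2
          exact ⟨by simp [h2, hu1], hu2, hu3⟩
  obtain ⟨r, hr, hrk⟩ := key _ Finset.univ rfl
  let : LinearOrder α := LinearOrder.lift' r fun a b hab => hr (by simp) (by simp) hab
  have hlt : ∀ a b : α, a < b ↔ r a < r b := fun a b => Iff.rfl
  let n := Fintype.orderIsoFinOfCardEq α hm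
  refine ⟨n.toEquiv, fun i => ?_⟩
  refine le_trans ?_ (hrk (n i) (Finset.mem_univ _))
  refine Set.ncard_le_ncard_of_injOn n (fun j hj => ⟨Finset.mem_univ _, ?_, hj.2⟩)
    n.injective.injOn (Set.toFinite _)
  rw [← hlt]
  exact n.lt_iff_lt.2 hj.1

/-- Flags of a polyhedron counted in two ways: if every edge has two endpoints and lies in two
faces, and any incident vertex and face have two edges between them, then there are twice as many
incident pairs as edges. -/
lemma card_incidence_of_diamond {V E F : Type*} [Fintype V] [Fintype E] [Fintype F]
    (I : V → F → Prop) (J : V → E → Prop) (K : E → F → Prop) (hI : ∀ v e f, J v e → K e f → I v f)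
    (hv : ∀ e, {v | J v e}.ncard = 2) (hf : ∀ e, {f | K e f}.ncard = 2)
    (he : ∀ v f, I v f → {e | J v e ∧ K e f}.ncard = 2) :
    Nat.card {p : V × F // I p.1 p.2} = 2 * Fintype.card E := by
  classical
  have key := Finset.sum_card_bipartiteAbove_eq_sum_card_bipartiteBelow
    (fun (p : V × F) (e : E) => J p.1 e ∧ K e p.2)
    (s := Finset.univ.filter fun p : V × F => I p.1 p.2) (t := Finset.univ)
  have h1 : ∀ p ∈ Finset.univ.filter fun p : V × F => I p.1 p.2,
      (Finset.bipartiteAbove (fun (p : V × F) (e : E) => J p.1 e ∧ K e p.2) Finset.univ p).card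
        = 2 := by
    intro p hp
    rw [← he p.1 p.2 (by simpa using hp), Set.ncard_eq_toFinset_card']
    congr 1
    ext e
    simp
  have h2 : ∀ e ∈ (Finset.univ : Finset E),
      (Finset.bipartiteBelow (fun (p : V × F) (e : E) => J p.1 e ∧ K e p.2)
        (Finset.univ.filter fun p : V × F => I p.1 p.2) e).card = 4 := by
    intro e _
    have : Finset.bipartiteBelow (fun (p : V × F) (e : E) => J p.1 e ∧ K e p.2)
        (Finset.univ.filter fun p : V × F => I p.1 p.2) e
        = (Finset.univ.filter fun v => J v e) ×ˢ (Finset.univ.filter fun f => K e f) := by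
      ext p
      simp only [Finset.mem_bipartiteBelow, Finset.mem_filter, Finset.mem_univ, true_and,
        Finset.mem_product, and_iff_right_iff_imp]
      exact fun h => hI _ _ _ h.1 h.2
    have hv' := hv e
    have hf' := hf e
    rw [Set.ncard_eq_toFinset_card', Set.toFinset_ofPred] at hv' hf'
    rw [this, Finset.card_product, hv', hf']
  rw [Finset.sum_const_nat h1, Finset.sum_const_nat h2, Finset.card_univ] at key
  rw [Nat.card_eq_fintype_card, Fintype.card_subtype]
  omega

/-- The combinatorial trace of a generic linear function on a three-dimensional polytope: each
face has a highest and a lowest vertex, and every vertex, except the highest one and the lowest one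
of the polytope, is neither the highest nor the lowest vertex of exactly two of its faces. -/
structure Sweep {V F : Type*} (I : V → F → Prop) where
  /-- The height of a vertex. -/
  height : V → ℝ
  /-- The highest vertex of a face. -/
  top : F → V
  /-- The lowest vertex of a face. -/
  bot : F → V
  /-- The highest vertex. -/
  north : V
  /-- The lowest vertex. -/
  south : V
  top_inc : ∀ f, I (top f) f
  bot_inc : ∀ f, I (bot f) f
  bot_ne_top : ∀ f, bot f ≠ top f
  height_lt : ∀ v f, I v f → v ≠ top f → height v < height (top f)
  south_ne_north : south ≠ north
  north_extreme : ∀ f, I north f → north = top f ∨ north = bot f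
  south_extreme : ∀ f, I south f → south = top f ∨ south = bot f
  middle : ∀ v, v ≠ north → v ≠ south → {f | I v f ∧ v ≠ top f ∧ v ≠ bot f}.ncard = 2

namespace Sweep

variable {V F : Type} {I : V → F → Prop}

lemma ncard_middle_le (s : Sweep I) (v : V) :
    {f | I v f ∧ v ≠ s.top f ∧ v ≠ s.bot f}.ncard ≤ 2 := by
  by_cases hn : v = s.north
  · subst hn
    rw [(Set.eq_empty_iff_forall_notMem (s := {f | _})).2]
    · simp
    · rintro f ⟨h1, h2, h3⟩
      exact (s.north_extreme f h1).elim h2 h3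
  by_cases hs : v = s.south
  · subst hs
    rw [(Set.eq_empty_iff_forall_notMem (s := {f | _})).2]
    · simp
    · rintro f ⟨h1, h2, h3⟩
      exact (s.south_extreme f h1).elim h2 h3
  exact (s.middle v hn hs).le

variable [Fintype V] [Fintype F]

/-- Count the incident pairs `(v, f)` by faces if `v` is extreme in `f`, and by vertices if not.
Together with `card_incidence_of_diamond` this is Euler's formula. -/
lemma card_incidence (s : Sweep I) :
    Nat.card {p : V × F // I p.1 p.2} + 4 = 2 * Fintype.card V + 2 * Fintype.card F := by
  classical
  rw [Nat.card_eq_fintype_card, Fintype.card_subtype,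
    ← Finset.card_filter_add_card_filter_not
      (s := Finset.univ.filter fun p : V × F => I p.1 p.2)
      (fun p => p.1 = s.top p.2 ∨ p.1 = s.bot p.2)]
  have h1 : ((Finset.univ.filter fun p : V × F => I p.1 p.2).filter
      fun p => p.1 = s.top p.2 ∨ p.1 = s.bot p.2).card = 2 * Fintype.card F := by
    rw [Finset.card_eq_sum_card_fiberwise (f := Prod.snd) (t := Finset.univ) (by simp),
      Finset.sum_const_nat (m := 2), Finset.card_univ, mul_comm]
    intro f _
    have : ((Finset.univ.filter fun p : V × F => I p.1 p.2).filter
        fun p => p.1 = s.top p.2 ∨ p.1 = s.bot p.2).filter (fun p => p.2 = f)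
        = {(s.bot f, f), (s.top f, f)} := by
      ext ⟨v, g⟩
      simp only [Finset.mem_filter, Finset.mem_univ, true_and, Finset.mem_insert,
        Finset.mem_singleton, Prod.mk.injEq]
      constructor
      · rintro ⟨⟨-, h | h⟩, rfl⟩
        · exact Or.inr ⟨h, rfl⟩
        · exact Or.inl ⟨h, rfl⟩
      · rintro (⟨rfl, rfl⟩ | ⟨rfl, rfl⟩)
        · exact ⟨⟨s.bot_inc _, Or.inr rfl⟩, rfl⟩
        · exact ⟨⟨s.top_inc _, Or.inl rfl⟩, rfl⟩
    rw [this, Finset.card_pair]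
    exact fun h => s.bot_ne_top f (Prod.mk.inj h).1
  have h2 : ((Finset.univ.filter fun p : V × F => I p.1 p.2).filter
      fun p => ¬ (p.1 = s.top p.2 ∨ p.1 = s.bot p.2)).card + 4 = 2 * Fintype.card V := by
    rw [Finset.card_eq_sum_card_fiberwise (f := Prod.fst)
      (t := Finset.univ \ {s.south, s.north}), Finset.sum_const_nat (m := 2)]
    · have := Finset.card_sdiff_add_card_eq_card
        (Finset.subset_univ ({s.south, s.north} : Finset V))
      rw [Finset.card_pair s.south_ne_north, Finset.card_univ] at this
      omega
    · intro v hv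
      simp only [Finset.mem_sdiff, Finset.mem_univ, true_and, Finset.mem_insert,
        Finset.mem_singleton, not_or] at hv
      have hm := s.middle v hv.2 hv.1
      rw [Set.ncard_eq_toFinset_card'] at hm
      refine (congrArg Finset.card ?_).trans ((Finset.card_map
        (⟨fun f => (v, f), Prod.mk_right_injective v⟩ : F ↪ V × F)).trans hm)
      ext ⟨w, g⟩
      simp only [Finset.mem_filter, Finset.mem_univ, true_and, Finset.mem_map, Set.mem_toFinset,
        Set.mem_ofPred_eq, Function.Embedding.coeFn_mk, Prod.mk.injEq, not_or]
      constructor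
      · rintro ⟨⟨h1, h2⟩, rfl⟩
        exact ⟨g, ⟨h1, h2⟩, rfl, rfl⟩
      · rintro ⟨f, ⟨h1, h2⟩, rfl, rfl⟩
        exact ⟨⟨h1, h2⟩, rfl⟩
    · rintro ⟨v, f⟩ hp
      simp only [Finset.coe_filter, Finset.mem_filter, Finset.mem_univ, true_and,
        Set.mem_ofPred_eq] at hp
      simp only [Finset.coe_sdiff, Finset.coe_univ, Finset.coe_insert, Finset.coe_singleton,
        Set.mem_sdiff, Set.mem_univ, true_and, Set.mem_insert_iff, Set.mem_singleton_iff]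
      rintro (rfl | rfl)
      · exact hp.2 (s.south_extreme f hp.1)
      · exact hp.2 (s.north_extreme f hp.1)
  omega

/-- Orient an incident pair `(v, f)` away from `f` if `v` is extreme in `f`, and away from `v` if
not. Then every out-degree is at most two, so if all degrees within a set `T` are at least four,
then every element of `T` has exactly two out-neighbours in `T`. This is impossible: the highest
vertex in `T` would have an out-neighbour `f` in `T`, and the highest vertex of `f`, which is
higher, would be in `T` too. -/
lemma exists_degree_le_three (s : Sweep I) (T : Finset (V ⊕ F)) (hT : T.Nonempty) :
    ∃ x ∈ T, {t | t ∈ T ∧ (leviGraph I).Adj t x}.ncard ≤ 3 := by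
  classical
  by_contra! hcon
  obtain ⟨A, hmA⟩ : ∃ A : Finset V, ∀ v, v ∈ A ↔ .inl v ∈ T :=
    ⟨Finset.univ.filter fun v => .inl v ∈ T, by simp⟩
  obtain ⟨B, hmB⟩ : ∃ B : Finset F, ∀ f, f ∈ B ↔ .inr f ∈ T :=
    ⟨Finset.univ.filter fun f => .inr f ∈ T, by simp⟩
  have hdA : ∀ v ∈ A, 4 ≤ (B.filter fun f => I v f).card := by
    intro v hv
    refine (hcon _ ((hmA v).1 hv)).trans_le (le_of_eq ?_)
    rw [← Set.ncard_coe_finset]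
    refine Eq.trans (congrArg Set.ncard ?_)
      (Set.ncard_image_of_injective _ (Sum.inr_injective (α := V)))
    ext (w | f)
    · simp [leviGraph]
    · simp [leviGraph, hmB]
  have hdB : ∀ f ∈ B, 4 ≤ (A.filter fun v => I v f).card := by
    intro f hf
    refine (hcon _ ((hmB f).1 hf)).trans_le (le_of_eq ?_)
    rw [← Set.ncard_coe_finset]
    refine Eq.trans (congrArg Set.ncard ?_)
      (Set.ncard_image_of_injective _ (Sum.inl_injective (β := F)))
    ext (w | f)
    · simp [leviGraph, hmA]
    · simp [leviGraph]
  -- The out-degrees within `T`.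
  set a : V → ℕ := fun v => (B.filter fun f => I v f ∧ ¬ (v = s.top f ∨ v = s.bot f)).card with ha
  set b : F → ℕ := fun f => (A.filter fun v => I v f ∧ (v = s.top f ∨ v = s.bot f)).card with hb
  have ha2 : ∀ v ∈ A, a v ≤ 2 := fun v _ => by
    simp only [ha]
    rw [← Set.ncard_coe_finset]
    refine (Set.ncard_le_ncard ?_ (Set.toFinite _)).trans (s.ncard_middle_le v)
    intro f hf
    simpa [not_or] using (Finset.mem_filter.1 (Finset.mem_coe.1 hf)).2
  have hb2 : ∀ f ∈ B, b f ≤ 2 := fun f _ => by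
    refine (Finset.card_le_card (t := {s.top f, s.bot f}) fun v hv => ?_).trans Finset.card_le_two
    simpa using (Finset.mem_filter.1 hv).2.2
  have hcount1 := Finset.sum_card_bipartiteAbove_eq_sum_card_bipartiteBelow I (s := A) (t := B)
  have hcount2 := Finset.sum_card_bipartiteAbove_eq_sum_card_bipartiteBelow
    (fun v f => I v f ∧ (v = s.top f ∨ v = s.bot f)) (s := A) (t := B)
  simp only [Finset.bipartiteAbove, Finset.bipartiteBelow] at hcount1 hcount2
  have hsplit : ∀ v, (B.filter fun f => I v f).card
      = (B.filter fun f => I v f ∧ (v = s.top f ∨ v = s.bot f)).card + a v := by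
    intro v
    rw [← Finset.card_filter_add_card_filter_not (s := B.filter fun f => I v f)
      (fun f => v = s.top f ∨ v = s.bot f), Finset.filter_filter, Finset.filter_filter]
  have hS : ∑ v ∈ A, (B.filter fun f => I v f).card = ∑ f ∈ B, b f + ∑ v ∈ A, a v := by
    rw [Finset.sum_congr rfl fun v _ => hsplit v, Finset.sum_add_distrib, hcount2]
  have e1 : 4 * A.card ≤ ∑ v ∈ A, (B.filter fun f => I v f).card := by
    rw [mul_comm]; exact Finset.card_nsmul_le_sum A _ 4 hdA
  have e2 : 4 * B.card ≤ ∑ f ∈ B, (A.filter fun v => I v f).card := by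
    rw [mul_comm]; exact Finset.card_nsmul_le_sum B _ 4 hdB
  have e3 : ∑ v ∈ A, a v ≤ 2 * A.card := by
    rw [mul_comm]; exact Finset.sum_le_card_nsmul A _ 2 ha2
  have e4 : ∑ f ∈ B, b f ≤ 2 * B.card := by
    rw [mul_comm]; exact Finset.sum_le_card_nsmul B _ 2 hb2
  have ha' : ∀ v ∈ A, a v = 2 := by
    refine (Finset.sum_eq_sum_iff_of_le ha2).1 ?_
    rw [Finset.sum_const, smul_eq_mul]
    omega
  have hb' : ∀ f ∈ B, b f = 2 := by
    refine (Finset.sum_eq_sum_iff_of_le hb2).1 ?_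
    rw [Finset.sum_const, smul_eq_mul]
    omega
  have hAne : A.Nonempty := by
    obtain ⟨v | f, hx⟩ := hT
    · exact ⟨v, (hmA v).2 hx⟩
    · have := hdB f ((hmB f).2 hx)
      obtain ⟨v, hv⟩ := Finset.card_pos.1 (by omega : 0 < (A.filter fun v => I v f).card)
      exact ⟨v, (Finset.mem_filter.1 hv).1⟩
  obtain ⟨v, hv, hmax⟩ := A.exists_max_image s.height hAne
  obtain ⟨f, hf⟩ := Finset.card_pos.1 ((ha' v hv).symm ▸ two_pos : 0 < a v)
  rw [Finset.mem_filter, not_or] at hf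
  obtain ⟨hfB, hvf, hvt, -⟩ := hf
  have htop : s.top f ∈ A := by
    by_contra htop
    have : b f ≤ 1 := by
      refine (Finset.card_le_card (t := {s.bot f}) fun w hw => ?_).trans
        (Finset.card_singleton _).le
      rw [Finset.mem_filter] at hw
      rcases hw.2.2 with h | h
      · exact absurd (h ▸ hw.1) htop
      · exact Finset.mem_singleton.2 h
    have := hb' f hfB
    omega
  exact absurd (hmax _ htop) (s.height_lt v f hvf hvt).not_ge

end Sweep

/-! ### The incidences of a polyhedron -/

lemma ncard_subtype_setOf {α : Type*} {s : Set α} (q : α → Prop) :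
    {x : s | q x}.ncard = {x | x ∈ s ∧ q x}.ncard := by
  rw [← Set.ncard_image_of_injective _ Subtype.val_injective]
  refine congrArg Set.ncard ?_
  ext x
  constructor
  · rintro ⟨y, hy, rfl⟩
    exact ⟨y.2, hy⟩
  · rintro ⟨h1, h2⟩
    exact ⟨⟨x, h1⟩, h2, rfl⟩

namespace HalfSpaceSystem

variable {ι : Type*} [Finite ι] {S : HalfSpaceSystem ι E3}

lemma mem_vertices_iff {p v : E3} (hp : p ∈ S.carrier) (hp0 : S.active p = ∅) :
    v ∈ vertices S.carrier ↔ v ∈ S.carrier ∧ S.dir v = ⊥ := by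
  rw [vertices_eq hp hp0, Set.mem_ofPred_eq]

lemma mem_faces_iff {p : E3} {f : Set E3} (hp : p ∈ S.carrier) (hp0 : S.active p = ∅) :
    f ∈ faces S.carrier ↔ ∃ x ∈ S.carrier, f = S.face x ∧ finrank ℝ (S.dir x) = 2 := by
  rw [faces_eq hp hp0, Set.mem_ofPred_eq]

lemma finite_vertices_carrier {p : E3} (hp : p ∈ S.carrier) (hp0 : S.active p = ∅) :
    (vertices S.carrier).Finite := by
  rw [vertices_eq hp hp0]
  exact finite_vertices S

lemma finite_edges_carrier {p : E3} (hp : p ∈ S.carrier) (hp0 : S.active p = ∅) :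
    (edges S.carrier).Finite := by
  rw [edges_eq hp hp0]
  exact (finite_faces S).subset fun f ⟨x, hx, h, _⟩ => ⟨x, hx, h⟩

lemma finite_faces_carrier {p : E3} (hp : p ∈ S.carrier) (hp0 : S.active p = ∅) :
    (faces S.carrier).Finite := by
  rw [faces_eq hp hp0]
  exact (finite_faces S).subset fun f ⟨x, hx, h, _⟩ => ⟨x, hx, h⟩

lemma card_incidence_carrier {p : E3} (hS : Bornology.IsBounded S.carrier)
    (hp : p ∈ S.carrier) (hp0 : S.active p = ∅) :
    Nat.card (Incidence (Incident S.carrier)) = 2 * (edges S.carrier).ncard := by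
  have : Fintype (vertices S.carrier) := (finite_vertices_carrier hp hp0).fintype
  have : Fintype (edges S.carrier) := (finite_edges_carrier hp hp0).fintype
  have : Fintype (faces S.carrier) := (finite_faces_carrier hp hp0).fintype
  have key := card_incidence_of_diamond (V := vertices S.carrier) (E := edges S.carrier)
    (F := faces S.carrier) (Incident S.carrier) (fun v e => v.1 ∈ e.1) (fun e f => e.1 ⊆ f.1)
    (fun v e f h1 h2 => h2 h1) ?_ ?_ ?_
  · rw [key, ← Nat.card_eq_fintype_card, Nat.card_coe_set_eq]
  · rintro ⟨e, he⟩
    rw [ncard_subtype_setOf (fun v => v ∈ e)]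
    rw [edges_eq hp hp0] at he
    obtain ⟨x, hx, rfl, hd⟩ := he
    rw [← ncard_vertices_of_finrank_eq_one hS hx hd, vertices_eq hp hp0]
    refine congrArg Set.ncard ?_
    ext v
    exact ⟨fun h => ⟨h.2, h.1.2⟩, fun h => ⟨⟨h.1.1, h.2⟩, h.1⟩⟩
  · rintro ⟨e, he⟩
    rw [ncard_subtype_setOf (fun f => e ⊆ f)]
    rw [edges_eq hp hp0] at he
    obtain ⟨x, hx, rfl, hd⟩ := he
    have h := ncard_between hx hp (by rw [hp0]; exact Set.empty_subset _)
      (by rw [dir_eq_top_of_active_eq_empty hp0, finrank_top, finrank_E3, hd])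
    rw [← h, faces_eq hp hp0]
    refine congrArg Set.ncard ?_
    ext f
    constructor
    · rintro ⟨⟨y, hy, rfl, hdy⟩, hf⟩
      exact ⟨y, hy, rfl, by rw [hp0]; exact Set.empty_subset _,
        (face_subset_face_iff hx).1 hf, by omega⟩
    · rintro ⟨y, hy, rfl, -, hf, hdy⟩
      exact ⟨⟨y, hy, rfl, by omega⟩, (face_subset_face_iff hx).2 hf⟩
  · rintro ⟨v, hv⟩ ⟨f, hf⟩ hvf
    rw [ncard_subtype_setOf (fun e => v ∈ e ∧ e ⊆ f)]
    rw [vertices_eq hp hp0] at hv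
    have hvf : v ∈ f := hvf
    rw [faces_eq hp hp0] at hf
    obtain ⟨x, hx, rfl, hd⟩ := hf
    have hdv : finrank ℝ (S.dir v) = 0 := Submodule.finrank_eq_zero.2 hv.2
    have h := ncard_between hv.1 hx hvf.2 (by omega)
    rw [← h, edges_eq hp hp0]
    refine congrArg Set.ncard ?_
    ext e
    constructor
    · rintro ⟨⟨y, hy, rfl, hdy⟩, hve, hef⟩
      exact ⟨y, hy, rfl, (face_subset_face_iff hy).1 hef, hve.2, by omega⟩
    · rintro ⟨y, hy, rfl, h1, h2, hdy⟩
      exact ⟨⟨y, hy, rfl, by omega⟩, ⟨hv.1, h2⟩, (face_subset_face_iff hy).2 h1⟩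

lemma exists_injOn_inner (S : HalfSpaceSystem ι E3) :
    ∃ h : E3, Set.InjOn (fun z => (inner ℝ h z : ℝ)) {v | v ∈ S.carrier ∧ S.dir v = ⊥} := by
  set A := {v | v ∈ S.carrier ∧ S.dir v = ⊥} with hA
  have : Finite A := finite_vertices S
  obtain ⟨f, hf⟩ := Module.exists_dual_forall_apply_ne_zero (K := ℝ)
    (fun q : {q : A × A // q.1 ≠ q.2} => (q.1.1.1 - q.1.2.1 : E3))
    (fun q => sub_ne_zero.2 fun h => q.2 (Subtype.ext h))
  refine ⟨(InnerProductSpace.toDual ℝ E3).symm (LinearMap.toContinuousLinearMap f),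
    fun v hv w hw hvw => ?_⟩
  by_contra hne
  refine hf ⟨⟨⟨v, hv⟩, ⟨w, hw⟩⟩, fun h => hne (congrArg Subtype.val h)⟩ ?_
  simp only [InnerProductSpace.toDual_symm_apply, LinearMap.coe_toContinuousLinearMap'] at hvw
  simp [hvw]

/-- A generic linear function sweeps the polytope. -/
lemma nonempty_sweep {p : E3} (hS : Bornology.IsBounded S.carrier)
    (hp : p ∈ S.carrier) (hp0 : S.active p = ∅) : Nonempty (Sweep (Incident S.carrier)) := by
  obtain ⟨h, hh⟩ := exists_injOn_inner S
  have hV := vertices_eq hp hp0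
  have hF := faces_eq hp hp0
  have htop : ∀ x ∈ S.carrier, ∃ v : vertices S.carrier, v.1 ∈ S.face x ∧
      ∀ z ∈ S.face x, (inner ℝ h z : ℝ) ≤ inner ℝ h v.1 := fun x hx => by
    obtain ⟨v, hv, h1, h2⟩ := exists_vertex_max hS hx h
    exact ⟨⟨v, by rw [hV]; exact ⟨hv.1, h1⟩⟩, hv, h2⟩
  have hbot : ∀ x ∈ S.carrier, ∃ v : vertices S.carrier, v.1 ∈ S.face x ∧
      ∀ z ∈ S.face x, (inner ℝ h v.1 : ℝ) ≤ inner ℝ h z := fun x hx => by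
    obtain ⟨v, hv, h1, h2⟩ := exists_vertex_min hS hx h
    exact ⟨⟨v, by rw [hV]; exact ⟨hv.1, h1⟩⟩, hv, h2⟩
  have hinj : ∀ v w : vertices S.carrier, (inner ℝ h v.1 : ℝ) = inner ℝ h w.1 → v = w :=
    fun v w hvw => Subtype.ext (hh (hV ▸ v.2) (hV ▸ w.2) hvw)
  -- On a set with a nonzero direction, the extreme vertices differ.
  have hne : ∀ x ∈ S.carrier, S.dir x ≠ ⊥ → ∀ v w : vertices S.carrier,
      (∀ z ∈ S.face x, (inner ℝ h z : ℝ) ≤ inner ℝ h v.1) →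
      (∀ z ∈ S.face x, (inner ℝ h w.1 : ℝ) ≤ inner ℝ h z) → w ≠ v := by
    rintro x hx hd v w hv hw rfl
    obtain ⟨u, hu, hu0⟩ := exists_mem_dir_inner_ne_zero hS hx hh hd
    obtain ⟨t, ht, h1, h2⟩ := exists_step_of_mem_dir hx hu
    have e1 := hv _ ⟨h1, h2.ge⟩
    have e2 := hw _ ⟨h1, h2.ge⟩
    have e3 := hv _ (mem_face_self hx)
    have e4 := hw _ (mem_face_self hx)
    rw [inner_add_right, real_inner_smul_right] at e1 e2
    exact mul_ne_zero ht.ne' hu0 (by linarith)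
  have hface : ∀ f : faces S.carrier, ∃ x ∈ S.carrier, f.1 = S.face x ∧
      finrank ℝ (S.dir x) = 2 := fun f => (mem_faces_iff hp hp0).1 f.2
  choose x hxS hxf hxd using hface
  choose T hT hTmax using htop
  choose B hB hBmin using hbot
  have hcar : S.face p = S.carrier := by
    ext z
    refine ⟨fun hz => hz.1, fun hz => ⟨hz, by rw [hp0]; exact Set.empty_subset _⟩⟩
  have hmem : ∀ v : vertices S.carrier, v.1 ∈ S.carrier ∧ S.dir v.1 = ⊥ :=
    fun v => (mem_vertices_iff hp hp0).1 v.2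
  refine ⟨{
    height := fun v => inner ℝ h v.1
    top := fun f => T (x f) (hxS f)
    bot := fun f => B (x f) (hxS f)
    north := T p hp
    south := B p hp
    top_inc := fun f => ?_
    bot_inc := fun f => ?_
    bot_ne_top := fun f => ?_
    height_lt := fun v f hvf hv => ?_
    south_ne_north := ?_
    north_extreme := fun f hf => Or.inl ?_
    south_extreme := fun f hf => Or.inr ?_
    middle := fun v hvn hvs => ?_ }⟩
  · change _ ∈ f.1
    rw [hxf f]
    exact hT _ _
  · change _ ∈ f.1
    rw [hxf f]
    exact hB _ _
  · refine hne (x f) (hxS f) (fun h0 => ?_) _ _ (hTmax _ _) (hBmin _ _)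
    have := hxd f
    rw [Submodule.finrank_eq_zero.2 h0] at this
    omega
  · have hvf : v.1 ∈ f.1 := hvf
    rw [hxf f] at hvf
    exact lt_of_le_of_ne (hTmax _ _ _ hvf) fun he => hv (hinj _ _ he)
  · refine hne p hp (fun h0 => ?_) _ _ (hTmax _ _) (hBmin _ _)
    rw [dir_eq_top_of_active_eq_empty hp0] at h0
    exact top_ne_bot h0
  · have hf : (T p hp).1 ∈ f.1 := hf
    rw [hxf f] at hf
    refine hinj _ _ (le_antisymm (hTmax _ _ _ hf) (hTmax _ _ _ ?_))
    rw [hcar]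
    exact (hmem _).1
  · have hf : (B p hp).1 ∈ f.1 := hf
    rw [hxf f] at hf
    refine hinj _ _ (le_antisymm (hBmin _ _ _ ?_) (hBmin _ _ _ hf))
    rw [hcar]
    exact (hmem _).1
  · have hup : (inner ℝ h v.1 : ℝ) < inner ℝ h (T p hp).1 :=
      lt_of_le_of_ne (hTmax p hp _ (hcar.symm ▸ (hmem v).1)) fun he => hvn (hinj _ _ he)
    have hdown : (inner ℝ h (B p hp).1 : ℝ) < inner ℝ h v.1 :=
      lt_of_le_of_ne (hBmin p hp _ (hcar.symm ▸ (hmem v).1)) fun he => hvs (hinj _ _ he.symm)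
    rw [← ncard_middle finrank_E3 hS hp hp0 hh (hmem v).1 (hmem v).2
      ⟨_, (hmem _).1, hup⟩ ⟨_, (hmem _).1, hdown⟩,
      ← Set.ncard_image_of_injective _ Subtype.val_injective]
    refine congrArg Set.ncard ?_
    ext f
    constructor
    · rintro ⟨f, ⟨h1, h2, h3⟩, rfl⟩
      have h1 : v.1 ∈ f.1 := h1
      have h1' := h1
      rw [hxf f] at h1
      refine ⟨x f, hxS f, hxf f, h1.2, hxd f, ⟨_, by rw [hxf f]; exact hT _ (hxS f), ?_⟩,
        ⟨_, by rw [hxf f]; exact hB _ (hxS f), ?_⟩⟩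
      · exact lt_of_le_of_ne (hTmax _ _ _ h1) fun he => h2 (hinj _ _ he)
      · exact lt_of_le_of_ne (hBmin _ _ _ h1) fun he => h3 (hinj _ _ he.symm)
    · rintro ⟨y, hy, rfl, h1, h2, ⟨q, hq, hq'⟩, ⟨r, hr, hr'⟩⟩
      have hf : S.face y ∈ faces S.carrier := by rw [hF]; exact ⟨y, hy, rfl, h2⟩
      refine ⟨⟨_, hf⟩, ⟨⟨(hmem v).1, h1⟩, fun he => ?_, fun he => ?_⟩, rfl⟩
      · have e1 := hTmax (x ⟨_, hf⟩) (hxS _) q (by rw [← hxf ⟨_, hf⟩]; exact hq)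
        rw [← he] at e1
        linarith
      · have e1 := hBmin (x ⟨_, hf⟩) (hxS _) r (by rw [← hxf ⟨_, hf⟩]; exact hr)
        rw [← he] at e1
        linarith

end HalfSpaceSystem

/-- At most three vectors in an open half-space are linearly independent if each of them spans an
exposed ray of the cone that they generate. (In a linear relation between at most three vectors,
there is at most one positive coefficient, or at most one negative one.) -/
lemma eq_zero_of_sum_smul_eq_zero {ι E : Type*} [AddCommGroup E] [Module ℝ E] {T : Finset ι}
    (hT : T.card ≤ 3) {y : ι → E} {g : E →ₗ[ℝ] ℝ} (hg : ∀ i ∈ T, 0 < g (y i))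
    (hsep : ∀ i ∈ T, ∃ l : E →ₗ[ℝ] ℝ, l (y i) = 0 ∧ ∀ j ∈ T, j ≠ i → 0 < l (y j))
    {c : ι → ℝ} (hc : ∑ i ∈ T, c i • y i = 0) : ∀ i ∈ T, c i = 0 := by
  classical
  have key : ∀ c : ι → ℝ, ∑ i ∈ T, c i • y i = 0 → (T.filter fun i => 0 < c i).card ≤ 1 →
      ∀ i ∈ T, c i = 0 := by
    intro c hc hcard
    have happ : ∀ l : E →ₗ[ℝ] ℝ, ∑ i ∈ T, c i * l (y i) = 0 := fun l => by
      have := congrArg l hc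
      simpa using this
    have hnonpos : ∀ s, (∀ i ∈ T, i ≠ s → c i ≤ 0) → s ∈ T → ∀ i ∈ T, c i = 0 := by
      intro s hs hsT
      obtain ⟨l, hl0, hl⟩ := hsep s hsT
      have h0 : ∀ i ∈ T, i ≠ s → c i = 0 := by
        have hle : ∀ i ∈ T, c i * l (y i) ≤ 0 := fun i hi => by
          by_cases his : i = s
          · rw [his, hl0, mul_zero]
          · exact mul_nonpos_of_nonpos_of_nonneg (hs i hi his) (hl i hi his).le
        intro i hi his
        have := (Finset.sum_eq_zero_iff_of_nonpos hle).1 (happ l) i hi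
        exact (mul_eq_zero.1 this).resolve_right (hl i hi his).ne'
      have hs0 : c s = 0 := by
        have := happ g
        rw [Finset.sum_eq_single_of_mem s hsT fun i hi his => by rw [h0 i hi his, zero_mul]] at this
        exact (mul_eq_zero.1 this).resolve_right (hg s hsT).ne'
      intro i hi
      by_cases his : i = s
      · rw [his, hs0]
      · exact h0 i hi his
    intro i hi
    rcases Finset.eq_empty_or_nonempty (T.filter fun i => 0 < c i) with h | ⟨s, hs⟩
    · refine hnonpos i (fun j hj _ => not_lt.1 fun h' => ?_) hi i hi
      have : j ∈ T.filter fun i => 0 < c i := by simp [hj, h']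
      simp [h] at this
    · refine hnonpos s (fun j hj hjs => not_lt.1 fun h' => hjs ?_) (Finset.mem_filter.1 hs).1 i hi
      exact Finset.card_le_one.1 hcard j (by simp [hj, h']) s hs
  by_cases h1 : (T.filter fun i => 0 < c i).card ≤ 1
  · exact key c hc h1
  · intro i hi
    have h2 : (T.filter fun i => 0 < -c i).card ≤ 1 := by
      have hdisj : Disjoint (T.filter fun i => 0 < c i) (T.filter fun i => 0 < -c i) :=
        Finset.disjoint_filter.2 fun i _ h h' => by linarith
      have := Finset.card_le_card (Finset.union_subset (Finset.filter_subset (fun i => 0 < c i) T)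
        (Finset.filter_subset (fun i => 0 < -c i) T))
      rw [Finset.card_union_of_disjoint hdisj] at this
      omega
    have := key (fun i => -c i) (by simp [hc]) h2 i hi
    simpa using this

lemma exists_carrier_eq {o : E3} {π : Plane} (h : o ∉ π.carrier) :
    ∃ a : E3, π.carrier = {x | inner ℝ a (x - o) = 1} := by
  obtain ⟨n, hn, c, hc⟩ := π.isPlane
  rw [hc] at h
  have h0 : c - inner ℝ n o ≠ 0 := sub_ne_zero.2 fun h' => h h'.symm
  refine ⟨(c - inner ℝ n o : ℝ)⁻¹ • n, ?_⟩
  rw [hc]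
  ext x
  rw [Set.mem_ofPred_eq, Set.mem_ofPred_eq, real_inner_smul_left, inner_sub_right,
    inv_mul_eq_one₀ h0, sub_left_inj]
  exact eq_comm

lemma carrier_eq_planeCoeff {o : E3} {π : Plane} (h : o ∉ π.carrier) :
    π.carrier = {x | inner ℝ (planeCoeff o π) (x - o) = 1} := by
  have h' := exists_carrier_eq h
  rw [planeCoeff, dif_pos h']
  exact h'.choose_spec

lemma inner_planeCoeff {P : Set E3} {f : faces P} {o z : E3} (ho : o ∉ (facePlane P f).carrier)
    (hz : z ∈ f.1) : inner ℝ (planeCoeff o (facePlane P f)) (z - o) = (1 : ℝ) := by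
  have h1 : z ∈ (facePlane P f).carrier := f.2.2.1.choose_spec hz
  rw [carrier_eq_planeCoeff ho] at h1
  exact h1

namespace HalfSpaceSystem

variable {ι : Type*} [Finite ι] {S : HalfSpaceSystem ι E3}

/-- At most three vertices of a face have linearly independent position vectors. -/
lemma vertices_independent {p o : E3} (hp : p ∈ S.carrier) (hp0 : S.active p = ∅)
    {f : faces S.carrier} (ho : o ∉ (facePlane S.carrier f).carrier)
    {T : Finset (vertices S.carrier)} (hT : T.card ≤ 3) (hTf : ∀ v ∈ T, Incident S.carrier v f)
    {c : vertices S.carrier → ℝ} (hc : ∑ v ∈ T, c v • (v.1 - o) = 0) : ∀ v ∈ T, c v = 0 := by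
  have ha : ∀ v ∈ T, inner ℝ (planeCoeff o (facePlane S.carrier f)) (v.1 - o) = (1 : ℝ) :=
    fun v hv => inner_planeCoeff ho (hTf v hv)
  set a := planeCoeff o (facePlane S.carrier f)
  refine eq_zero_of_sum_smul_eq_zero hT (g := innerₗ E3 a)
    (fun v hv => by rw [innerₗ_apply_apply, ha v hv]; exact one_pos) (fun s hs => ?_) hc
  have hmem : ∀ v : vertices S.carrier, v.1 ∈ S.carrier ∧ S.dir v.1 = ⊥ :=
    fun v => (mem_vertices_iff hp hp0).1 v.2
  obtain ⟨m, -, d, hle, hiff, -⟩ := exists_supporting (x := s.1) hp hp0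
    (active_nonempty_of_dir_ne_top (by rw [(hmem s).2]; exact bot_ne_top))
  -- On the plane of the face, an affine functional agrees with a linear one.
  have hl : ∀ v ∈ T, (-(innerₗ E3 m + (d + inner ℝ m o : ℝ) • innerₗ E3 a)) (v.1 - o)
      = -(inner ℝ m v.1 + d) := fun v hv => by
    simp only [LinearMap.neg_apply, LinearMap.add_apply, LinearMap.smul_apply, innerₗ_apply_apply,
      ha v hv, inner_sub_right, smul_eq_mul]
    ring
  refine ⟨_, (hl s hs).trans ?_, fun v hv hvs => (hl v hv).symm ▸ ?_⟩
  · rw [(hiff _ (hmem s).1).1 (mem_face_self (hmem s).1), neg_zero]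
  · rw [neg_pos]
    refine lt_of_le_of_ne (hle _ (hmem v).1) fun h => hvs ?_
    have := (hiff _ (hmem v).1).2 h
    rw [face_eq_singleton (hmem s).1 (hmem s).2] at this
    exact Subtype.ext this

/-- At most three faces at a vertex have linearly independent normals. -/
lemma faces_independent {p o : E3} (hp : p ∈ S.carrier) (hp0 : S.active p = ∅)
    (ho : ∀ f, o ∉ (facePlane S.carrier f).carrier) {v : vertices S.carrier}
    {T : Finset (faces S.carrier)} (hT : T.card ≤ 3) (hTv : ∀ f ∈ T, Incident S.carrier v f)
    {c : faces S.carrier → ℝ} (hc : ∑ f ∈ T, c f • planeCoeff o (facePlane S.carrier f) = 0) :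
    ∀ f ∈ T, c f = 0 := by
  have hface : ∀ f : faces S.carrier, ∃ x ∈ S.carrier, f.1 = S.face x ∧
      finrank ℝ (S.dir x) = 2 := fun f => (mem_faces_iff hp hp0).1 f.2
  choose x hxS hxf hxd using hface
  have hsupp := fun f => exists_supporting (x := x f) hp hp0
    (active_nonempty_of_dir_ne_top (ne_top_of_finrank_le (hxd f).le))
  choose m hm d hle hiff _ using hsupp
  have hvf : ∀ f ∈ T, v.1 ∈ S.face (x f) := fun f hf => hxf f ▸ hTv f hf
  -- The coefficient vectors are nonzero multiples of the outer normals.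
  have hmul : ∀ f : faces S.carrier, ∃ r : ℝ, r ≠ 0 ∧
      planeCoeff o (facePlane S.carrier f) = r • m f := by
    intro f
    have hperp : ∀ w : E3, (∀ y ∈ S.face (x f), (inner ℝ w (y - x f) : ℝ) = 0) →
        w ∈ (S.dir (x f))ᗮ := by
      intro w hw
      rw [← vectorSpan_face (hxS f),
        vectorSpan_eq_span_vsub_set_right ℝ (mem_face_self (hxS f)),
        Submodule.mem_orthogonal']
      intro u hu
      induction hu using Submodule.span_induction with
      | mem u hu =>
        obtain ⟨y, hy, rfl⟩ := hu
        exact hw y hy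
      | zero => exact inner_zero_right _
      | add u u' _ _ h1 h2 => rw [inner_add_right, h1, h2, add_zero]
      | smul t u _ h1 => rw [real_inner_smul_right, h1, mul_zero]
    have hself : ∀ y ∈ S.face (x f), inner ℝ (planeCoeff o (facePlane S.carrier f)) (y - o)
        = (1 : ℝ) := fun y hy => inner_planeCoeff (ho f) (by rw [hxf f]; exact hy)
    have h1 : planeCoeff o (facePlane S.carrier f) ∈ (S.dir (x f))ᗮ := hperp _ fun y hy => by
      rw [← sub_sub_sub_cancel_right y (x f) o, inner_sub_right, hself y hy,
        hself _ (mem_face_self (hxS f)), sub_self]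
    have h2 : m f ∈ (S.dir (x f))ᗮ := hperp _ fun y hy => by
      have e1 := (hiff f y hy.1).1 hy
      have e2 := (hiff f _ (hxS f)).1 (mem_face_self (hxS f))
      rw [inner_sub_right]
      linarith
    have hrank : finrank ℝ (S.dir (x f))ᗮ = 1 := by
      have := Submodule.finrank_add_finrank_orthogonal (S.dir (x f))
      rw [hxd f, finrank_E3] at this
      omega
    obtain ⟨r, hr⟩ := (finrank_eq_one_iff_of_nonzero' (⟨m f, h2⟩ : (S.dir (x f))ᗮ)
      (fun h => hm f (congrArg Subtype.val h))).1 hrank ⟨_, h1⟩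
    have hr : r • m f = planeCoeff o (facePlane S.carrier f) := congrArg Subtype.val hr
    refine ⟨r, fun h0 => ?_, hr.symm⟩
    have := hself _ (mem_face_self (hxS f))
    rw [← hr, h0, zero_smul, inner_zero_left] at this
    exact zero_ne_one this
  choose r hr0 hr using hmul
  have hval : ∀ f ∈ T, ∀ y : E3, (-(innerₗ E3 (y - v.1))) (m f) = -(inner ℝ (m f) y + d f) :=
    fun f hf y => by
      have := (hiff f _ (hvf f hf).1).1 (hvf f hf)
      rw [LinearMap.neg_apply, innerₗ_apply_apply, real_inner_comm, inner_sub_right]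
      linarith
  have hpos : ∀ f ∈ T, ∀ y ∈ S.carrier, y ∉ S.face (x f) →
      0 < (-(innerₗ E3 (y - v.1))) (m f) := fun f hf y hy hyf => by
    rw [hval f hf, neg_pos]
    exact lt_of_le_of_ne (hle f y hy) fun h => hyf ((hiff f y hy).2 h)
  have key := eq_zero_of_sum_smul_eq_zero hT (y := m) (c := fun f => c f * r f)
    (g := -(innerₗ E3 (p - v.1))) (fun f hf => hpos f hf p hp fun h => ?_) (fun s hs => ?_) ?_
  · intro f hf
    exact (mul_eq_zero.1 (key f hf)).resolve_right (hr0 f)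
  · have hne := active_nonempty_of_dir_ne_top (ne_top_of_finrank_le (hxd f).le)
    have := h.2
    rw [hp0, Set.subset_empty_iff] at this
    exact hne.ne_empty this
  · refine ⟨-(innerₗ E3 (x s - v.1)), ?_, fun f hf hfs => hpos f hf _ (hxS s) fun h => hfs ?_⟩
    · rw [hval s hs, (hiff s _ (hxS s)).1 (mem_face_self (hxS s)), neg_zero]
    · apply Subtype.ext
      rw [hxf, hxf, face_eq_face_iff (hxS f) (hxS s)]
      exact active_eq_of_finrank_eq h.2 subset_rfl ((hxd f).trans (hxd s).symm)
  · rw [← hc]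
    exact Finset.sum_congr rfl fun f _ => by rw [hr f, smul_smul]

end HalfSpaceSystem

/-! ### The differentials of the incidence equations -/

section Derivative

variable {V F : Type} [Fintype V] [Fintype F] (I : V → F → Prop)

lemma contDiff_phi_apply (p : Incidence I) : ContDiff ℝ ∞ fun x => phi I x p := by
  unfold phi
  have h1 : ContDiff ℝ ∞ fun x : Coord V F => x.2 p.1.2 :=
    (contDiff_apply ℝ E3 p.1.2).comp contDiff_snd
  have h2 : ContDiff ℝ ∞ fun x : Coord V F => x.1 p.1.1 :=
    (contDiff_apply ℝ E3 p.1.1).comp contDiff_fst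
  exact (h1.inner ℝ h2).sub contDiff_const

lemma contDiff_phi [Fintype (Incidence I)] : ContDiff ℝ ∞ (phi I) :=
  contDiff_pi.2 fun p => contDiff_phi_apply I p

lemma fderiv_phi_apply (x δ : Coord V F) (p : Incidence I) :
    fderiv ℝ (fun x => phi I x p) x δ
      = inner ℝ (x.2 p.1.2) (δ.1 p.1.1) + inner ℝ (δ.2 p.1.2) (x.1 p.1.1) := by
  have h1 : HasFDerivAt (fun x : Coord V F => x.2 p.1.2)
      ((ContinuousLinearMap.proj (R := ℝ) (φ := fun _ : F => E3) p.1.2).comp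
        (ContinuousLinearMap.snd ℝ (V → E3) (F → E3))) x :=
    ((ContinuousLinearMap.proj (R := ℝ) (φ := fun _ : F => E3) p.1.2).comp
      (ContinuousLinearMap.snd ℝ (V → E3) (F → E3))).hasFDerivAt
  have h2 : HasFDerivAt (fun x : Coord V F => x.1 p.1.1)
      ((ContinuousLinearMap.proj (R := ℝ) (φ := fun _ : V => E3) p.1.1).comp
        (ContinuousLinearMap.fst ℝ (V → E3) (F → E3))) x :=
    ((ContinuousLinearMap.proj (R := ℝ) (φ := fun _ : V => E3) p.1.1).comp
      (ContinuousLinearMap.fst ℝ (V → E3) (F → E3))).hasFDerivAt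
  have h := (h1.inner ℝ h2).sub_const 1
  have h' : fderiv ℝ (fun x => phi I x p) x = _ := h.fderiv
  rw [h']
  simp [fderivInnerCLM_apply]

variable {I}

/-- The differentials are linearly independent if the incidence graph is `3`-degenerate, any three
points on a plane are independent, and any three planes through a point are. Indeed, among the
elements that occur in a nontrivial linear relation, choose one, `s`, that is incident with at most
three of the others. The variations of `s` alone give a relation between the coordinates of these
at most three elements. -/
lemma linearIndependent_fderiv
    (hdeg : ∀ T : Finset (V ⊕ F), T.Nonempty →
      ∃ s ∈ T, {t | t ∈ T ∧ (leviGraph I).Adj t s}.ncard ≤ 3) {x : Coord V F}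
    (hV : ∀ f, ∀ T : Finset V, T.card ≤ 3 → (∀ v ∈ T, I v f) → ∀ c : V → ℝ,
      ∑ v ∈ T, c v • x.1 v = 0 → ∀ v ∈ T, c v = 0)
    (hF : ∀ v, ∀ T : Finset F, T.card ≤ 3 → (∀ f ∈ T, I v f) → ∀ c : F → ℝ,
      ∑ f ∈ T, c f • x.2 f = 0 → ∀ f ∈ T, c f = 0) :
    LinearIndependent ℝ fun p : Incidence I => fderiv ℝ (fun x => phi I x p) x := by
  classical
  have : Fintype (Incidence I) := Fintype.ofFinite _
  rw [Fintype.linearIndependent_iff]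
  intro g hg
  -- Extend the coefficients by zero to all pairs.
  set c : V → F → ℝ := fun v f => if h : I v f then g ⟨(v, f), h⟩ else 0 with hc
  have hcI : ∀ v f, c v f ≠ 0 → I v f := fun v f h => by
    by_contra h'
    exact h (by simp [hc, h'])
  have hcg : ∀ p : Incidence I, c p.1.1 p.1.2 = g p := fun p => by simp [hc, p.2]
  have hrel : ∀ δ : Coord V F, ∑ v, ∑ f, c v f *
      ((inner ℝ (x.2 f) (δ.1 v) : ℝ) + inner ℝ (δ.2 f) (x.1 v)) = 0 := by
    intro δ
    have h1 := congrArg (fun L => L δ) hg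
    simp only [sum_apply, smul_apply, fderiv_phi_apply, zero_apply, smul_eq_mul] at h1
    rw [← Fintype.sum_prod_type' (f := fun v f => c v f *
      ((inner ℝ (x.2 f) (δ.1 v) : ℝ) + inner ℝ (δ.2 f) (x.1 v))), ← h1]
    refine (Fintype.sum_of_injective Subtype.val Subtype.val_injective _ _ ?_ ?_).symm
    · intro p hp
      have : c p.1 p.2 = 0 := by
        by_contra h
        exact hp ⟨⟨p, hcI _ _ h⟩, rfl⟩
      rw [this, zero_mul]
    · intro p
      rw [hcg]
  have hrelF : ∀ f, ∑ v, c v f • x.1 v = 0 := by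
    intro f
    refine ext_inner_left ℝ fun w => ?_
    have := hrel (0, Pi.single f w)
    simp only [Pi.zero_apply, inner_zero_right, zero_add] at this
    rw [inner_sum, inner_zero_right, ← this]
    refine Finset.sum_congr rfl fun v _ => ?_
    rw [Finset.sum_eq_single f (fun f' _ h => by simp [Pi.single_eq_of_ne h]) (by simp),
      Pi.single_eq_same, real_inner_smul_right]
  have hrelV : ∀ v, ∑ f, c v f • x.2 f = 0 := by
    intro v
    refine ext_inner_right ℝ fun w => ?_
    have := hrel (Pi.single v w, 0)
    simp only [Pi.zero_apply, inner_zero_left, add_zero] at this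
    rw [sum_inner, inner_zero_left, ← this,
      Finset.sum_eq_single v (fun v' _ h => by simp [Pi.single_eq_of_ne h]) (by simp)]
    refine Finset.sum_congr rfl fun f _ => ?_
    rw [Pi.single_eq_same, real_inner_smul_left]
  by_contra! hne
  obtain ⟨p₀, hp₀⟩ := hne
  set T : Finset (V ⊕ F) := Finset.univ.filter fun s =>
    Sum.elim (fun v => ∃ f, c v f ≠ 0) (fun f => ∃ v, c v f ≠ 0) s with hT
  have hTl : ∀ v, .inl v ∈ T ↔ ∃ f, c v f ≠ 0 := fun v => by simp [hT]
  have hTr : ∀ f, .inr f ∈ T ↔ ∃ v, c v f ≠ 0 := fun f => by simp [hT]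
  obtain ⟨v | f, hs, hs3⟩ := hdeg T ⟨.inl p₀.1.1, (hTl _).2 ⟨p₀.1.2, by rwa [hcg]⟩⟩
  · obtain ⟨f₀, hf₀⟩ := (hTl v).1 hs
    set N : Finset F := Finset.univ.filter fun f => c v f ≠ 0 with hN
    refine hf₀ (hF v N (le_trans ?_ hs3) (fun f hf => hcI _ _ (Finset.mem_filter.1 hf).2) (c v) ?_
      f₀ (by simp [hN, hf₀]))
    · rw [← Set.ncard_coe_finset]
      refine Set.ncard_le_ncard_of_injOn Sum.inr (fun f hf => ?_) Sum.inr_injective.injOn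
        (Set.toFinite _)
      have hf : c v f ≠ 0 := (Finset.mem_filter.1 hf).2
      exact ⟨(hTr f).2 ⟨v, hf⟩, hcI _ _ hf⟩
    · rw [← hrelV v]
      refine Finset.sum_subset (Finset.subset_univ _) fun f _ hf => ?_
      have : c v f = 0 := by simpa [hN] using hf
      rw [this, zero_smul]
  · obtain ⟨v₀, hv₀⟩ := (hTr f).1 hs
    set N : Finset V := Finset.univ.filter fun v => c v f ≠ 0 with hN
    refine hv₀ (hV f N (le_trans ?_ hs3) (fun v hv => hcI _ _ (Finset.mem_filter.1 hv).2)
      (fun v => c v f) ?_ v₀ (by simp [hN, hv₀]))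
    · rw [← Set.ncard_coe_finset]
      refine Set.ncard_le_ncard_of_injOn Sum.inl (fun v hv => ?_) Sum.inl_injective.injOn
        (Set.toFinite _)
      have hv : c v f ≠ 0 := (Finset.mem_filter.1 hv).2
      exact ⟨(hTl v).2 ⟨f, hv⟩, hcI _ _ hv⟩
    · rw [← hrelF f]
      refine Finset.sum_subset (Finset.subset_univ _) fun v _ hv => ?_
      have : c v f = 0 := by simpa [hN] using hv
      rw [this, zero_smul]

lemma surjective_fderiv_phi {x : Coord V F}
    (h : LinearIndependent ℝ fun p : Incidence I => fderiv ℝ (fun x => phi I x p) x) :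
    Function.Surjective (fderiv ℝ (phi I) x) := by
  classical
  have : Fintype (Incidence I) := Fintype.ofFinite _
  rw [Fintype.linearIndependent_iff] at h
  have happ : ∀ δ p, fderiv ℝ (phi I) x δ p = fderiv ℝ (fun x => phi I x p) x δ := fun δ p => by
    rw [fderiv_apply ((contDiff_phi I).differentiable (by simp) x) p]
    rfl
  change Function.Surjective (fderiv ℝ (phi I) x).toLinearMap
  rw [← LinearMap.dualMap_injective_iff, injective_iff_map_eq_zero]
  intro l hl
  have hl' : ∀ y : Incidence I → ℝ, l y = ∑ p, l (Pi.single p 1) * y p := fun y => by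
    conv_lhs => rw [← Finset.univ_sum_single y]
    rw [map_sum]
    refine Finset.sum_congr rfl fun p _ => ?_
    rw [mul_comm, ← smul_eq_mul, ← map_smul, ← Pi.single_smul', smul_eq_mul, mul_one]
  have hzero := h (fun p => l (Pi.single p 1)) (by
    refine ContinuousLinearMap.ext fun δ => ?_
    have := congrArg (fun L => L δ) hl
    simp only [LinearMap.dualMap_apply', LinearMap.comp_apply] at this
    simp only [sum_apply, smul_apply, smul_eq_mul, ← happ, zero_apply]
    exact (hl' _).symm.trans this)
  ext y
  simp [hzero]

end Derivative

/-! ### Charts for the space of realizations -/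

/-- The implicit function theorem in the form of a straightening chart: near a point where a smooth
map `φ` is a submersion, `φ` and a suitable linear map `π` together are smooth coordinates. -/
lemma exists_straightening {X Y Z : Type*} [NormedAddCommGroup X] [NormedSpace ℝ X]
    [FiniteDimensional ℝ X] [NormedAddCommGroup Y] [NormedSpace ℝ Y] [FiniteDimensional ℝ Y]
    [NormedAddCommGroup Z] [NormedSpace ℝ Z] [FiniteDimensional ℝ Z]
    {φ : X → Y} (hφ : ContDiff ℝ ∞ φ) {x₀ : X} (hsurj : Function.Surjective (fderiv ℝ φ x₀))
    (hd : finrank ℝ X = finrank ℝ Y + finrank ℝ Z) {O : Set X} (hO : IsOpen O) (hx₀ : x₀ ∈ O) :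
    ∃ (Ψ : OpenPartialHomeomorph X (Y × Z)) (π : X →L[ℝ] Z), x₀ ∈ Ψ.source ∧ Ψ.source ⊆ O ∧
      (∀ x, Ψ x = (φ x, π x)) ∧ ContDiffOn ℝ ∞ Ψ.symm Ψ.target := by
  have : CompleteSpace X := FiniteDimensional.complete ℝ X
  set L := fderiv ℝ φ x₀ with hL
  have hker : finrank ℝ (LinearMap.ker L.toLinearMap) = finrank ℝ Z := by
    have h1 := LinearMap.finrank_range_add_finrank_ker L.toLinearMap
    rw [LinearMap.range_eq_top.2 hsurj, finrank_top] at h1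
    omega
  obtain ⟨ρ, hρ⟩ := LinearMap.exists_leftInverse_of_injective
    (LinearMap.ker L.toLinearMap).subtype (Submodule.ker_subtype _)
  let eK := LinearEquiv.ofFinrankEq _ _ hker
  let π : X →L[ℝ] Z := LinearMap.toContinuousLinearMap (eK.toLinearMap.comp ρ)
  have hinj : Function.Injective (L.toLinearMap.prod π.toLinearMap) := by
    rw [injective_iff_map_eq_zero]
    intro x hx
    obtain ⟨h1, h2⟩ := Prod.mk.inj hx
    have h2 : eK (ρ x) = 0 := h2
    have h3 : ρ ((LinearMap.ker L.toLinearMap).subtype ⟨x, h1⟩) = ⟨x, h1⟩ :=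
      congrArg (fun l => l ⟨x, h1⟩) hρ
    rw [map_eq_zero_iff _ eK.injective] at h2
    exact congrArg Subtype.val (h3.symm.trans h2)
  let A : X ≃L[ℝ] Y × Z := (LinearEquiv.ofInjectiveOfFinrankEq
    (L.toLinearMap.prod π.toLinearMap) hinj
      (by rw [hd, Module.finrank_prod])).toContinuousLinearEquiv
  have hA : (A : X →L[ℝ] Y × Z) = L.prod π := rfl
  have hΦ : ContDiff ℝ ∞ fun x => (φ x, π x) := hφ.prodMk π.contDiff
  have hder : ∀ x, HasFDerivAt (fun x => (φ x, π x)) ((fderiv ℝ φ x).prod π) x := fun x =>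
    ((hφ.differentiable (by simp) x).hasFDerivAt).prodMk π.hasFDerivAt
  let Ψ₀ := hΦ.contDiffAt.toOpenPartialHomeomorph (fun x => (φ x, π x)) (f' := A) (a := x₀)
    (hA ▸ hder x₀) (by simp)
  -- The inverse is smooth wherever the derivative is invertible, which is an open condition.
  set U : Set X := {x | (fderiv ℝ φ x).prod π ∈ Set.range
    (ContinuousLinearEquiv.toContinuousLinearMap : (X ≃L[ℝ] Y × Z) → X →L[ℝ] Y × Z)} with hU
  have hUo : IsOpen U := by
    refine ContinuousLinearEquiv.isOpen.preimage ?_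
    have h1 : Continuous (fderiv ℝ φ) := hφ.continuous_fderiv (by simp)
    have h2 : (fun x => (fderiv ℝ φ x).prod π) = fderiv ℝ fun x => (φ x, π x) :=
      funext fun x => (hder x).fderiv.symm
    rw [h2]
    exact hΦ.continuous_fderiv (by simp)
  have hx₀U : x₀ ∈ U := ⟨A, hA⟩
  have hsrc : (Ψ₀.restr (U ∩ O)).source = Ψ₀.source ∩ (U ∩ O) :=
    Ψ₀.restr_source' _ (hUo.inter hO)
  refine ⟨Ψ₀.restr (U ∩ O), π, ?_, ?_, fun x => rfl, ?_⟩
  · rw [hsrc]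
    exact ⟨ContDiffAt.mem_toOpenPartialHomeomorph_source _ _ _, hx₀U, hx₀⟩
  · rw [hsrc]
    exact fun x hx => hx.2.2
  · intro y hy
    have hmem := (Ψ₀.restr (U ∩ O)).map_target hy
    rw [hsrc] at hmem
    obtain ⟨B, hB⟩ := hmem.2.1
    refine ContDiffAt.contDiffWithinAt ?_
    refine OpenPartialHomeomorph.contDiffAt_symm _ (f₀' := B) hy ?_ hΦ.contDiffAt
    rw [hB]
    exact hder _

section Planes

lemma ofEquation_surjective : Function.Surjective Plane.ofEquation := by
  intro π
  obtain ⟨n, hn, c, h⟩ := π.isPlane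
  exact ⟨⟨(n, c), hn⟩, Plane.ext h.symm⟩

lemma isQuotientMap_ofEquation : IsQuotientMap Plane.ofEquation :=
  ⟨⟨rfl⟩, ofEquation_surjective⟩

lemma isOpen_notMem_plane (o : E3) : IsOpen {π : Plane | o ∉ π.carrier} := by
  rw [← isQuotientMap_ofEquation.isOpen_preimage]
  have : Plane.ofEquation ⁻¹' {π : Plane | o ∉ π.carrier}
      = {p | (inner ℝ p.1.1 o : ℝ) ≠ p.1.2} := rfl
  rw [this]
  exact isOpen_ne_fun (by fun_prop) (by fun_prop)

/-- The equation of a plane in the form `⟪a, x - o⟫ = 1` is unique. -/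
lemma eq_of_setOf_eq {o a b : E3} (ha : a ≠ 0) (hb : b ≠ 0)
    (h : {x : E3 | inner ℝ a (x - o) = (1 : ℝ)} = {x | inner ℝ b (x - o) = (1 : ℝ)}) : a = b := by
  have key : ∀ a b : E3, a ≠ 0 →
      {x : E3 | inner ℝ a (x - o) = (1 : ℝ)} ⊆ {x | inner ℝ b (x - o) = (1 : ℝ)} →
      (inner ℝ b a : ℝ) = inner ℝ a a := by
    intro a b ha h
    have haa : (inner ℝ a a : ℝ) ≠ 0 := inner_self_ne_zero.2 ha
    have h1 : o + (inner ℝ a a : ℝ)⁻¹ • a ∈ {x : E3 | inner ℝ a (x - o) = (1 : ℝ)} := by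
      rw [Set.mem_ofPred_eq, add_sub_cancel_left, real_inner_smul_right, inv_mul_cancel₀ haa]
    have h2 := h h1
    rw [Set.mem_ofPred_eq, add_sub_cancel_left, real_inner_smul_right, inv_mul_eq_one₀ haa] at h2
    exact h2.symm
  have h1 := key a b ha h.subset
  have h2 := key b a hb h.superset
  rw [← sub_eq_zero, ← inner_self_eq_zero (𝕜 := ℝ), inner_sub_left, inner_sub_right,
    inner_sub_right]
  linarith

lemma planeCoeff_ne_zero {o : E3} {π : Plane} (h : o ∉ π.carrier) : planeCoeff o π ≠ 0 := by
  intro h0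
  have h1 := carrier_eq_planeCoeff h
  obtain ⟨n, hn, c, hc⟩ := π.isPlane
  have hnn : (inner ℝ n n : ℝ) ≠ 0 := inner_self_ne_zero.2 hn
  have h2 : (c / inner ℝ n n : ℝ) • n ∈ π.carrier := by
    rw [hc, Set.mem_ofPred_eq, real_inner_smul_right, div_mul_cancel₀ _ hnn]
  rw [h1, h0, Set.mem_ofPred_eq, inner_zero_left] at h2
  exact zero_ne_one h2

lemma planeCoeff_eq {o a : E3} {π : Plane} (ha : a ≠ 0)
    (h : π.carrier = {x | inner ℝ a (x - o) = 1}) : planeCoeff o π = a := by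
  have ho : o ∉ π.carrier := by
    rw [h, Set.mem_ofPred_eq, sub_self, inner_zero_right]
    exact zero_ne_one
  exact eq_of_setOf_eq (planeCoeff_ne_zero ho) ha ((carrier_eq_planeCoeff ho).symm.trans h)

lemma continuousOn_planeCoeff (o : E3) :
    ContinuousOn (planeCoeff o) {π : Plane | o ∉ π.carrier} := by
  rw [isQuotientMap_ofEquation.continuousOn_isOpen_iff (isOpen_notMem_plane o)]
  have h0 : ∀ p ∈ Plane.ofEquation ⁻¹' {π : Plane | o ∉ π.carrier},
      p.1.2 - (inner ℝ p.1.1 o : ℝ) ≠ 0 := fun p hp => sub_ne_zero.2 fun h => hp h.symm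
  have hcont : ContinuousOn (fun p : {p : E3 × ℝ // p.1 ≠ 0} =>
      (p.1.2 - inner ℝ p.1.1 o : ℝ)⁻¹ • p.1.1)
      (Plane.ofEquation ⁻¹' {π : Plane | o ∉ π.carrier}) := by
    refine ContinuousOn.smul (ContinuousOn.inv₀ ?_ h0) ?_
    · exact Continuous.continuousOn (by fun_prop)
    · exact Continuous.continuousOn (by fun_prop)
  refine hcont.congr fun p hp => ?_
  refine planeCoeff_eq (smul_ne_zero (inv_ne_zero (h0 p hp)) p.2) ?_
  ext x
  change inner ℝ p.1.1 x = p.1.2 ↔ _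
  rw [Set.mem_ofPred_eq, real_inner_smul_left, inner_sub_right, inv_mul_eq_one₀ (h0 p hp),
    sub_left_inj]
  exact eq_comm

end Planes

section Realizations

variable {V F : Type} {I : V → F → Prop}

lemma Realization.continuous_point_plane :
    Continuous fun R : Realization I => (R.point, R.plane) := continuous_induced_dom

lemma Realization.continuous_point (v : V) : Continuous fun R : Realization I => R.point v :=
  (continuous_apply v).comp (continuous_fst.comp Realization.continuous_point_plane)

lemma Realization.continuous_plane (f : F) : Continuous fun R : Realization I => R.plane f :=
  (continuous_apply f).comp (continuous_snd.comp Realization.continuous_point_plane)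

lemma isOpen_avoiding [Finite F] (o : E3) :
    IsOpen {R : Realization I | ∀ f, o ∉ (R.plane f).carrier} := by
  simp only [Set.ofPred_forall]
  exact isOpen_iInter_of_finite fun f =>
    (isOpen_notMem_plane o).preimage (Realization.continuous_plane f)

lemma continuousOn_coords (o : E3) :
    ContinuousOn (coords o) {R : Realization I | ∀ f, o ∉ (R.plane f).carrier} := by
  refine ContinuousOn.prodMk (continuousOn_pi.2 fun v => ?_) (continuousOn_pi.2 fun f => ?_)
  · exact ((Realization.continuous_point v).sub continuous_const).continuousOn
  · exact (continuousOn_planeCoeff o).comp (Realization.continuous_plane f).continuousOn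
      fun R hR => hR f

lemma phi_coords {o : E3} {R : Realization I} (h : ∀ f, o ∉ (R.plane f).carrier) :
    phi I (coords o R) = 0 := by
  funext p
  have h1 := R.incident _ _ p.2
  rw [carrier_eq_planeCoeff (h p.1.2)] at h1
  have h1 : inner ℝ (planeCoeff o (R.plane p.1.2)) (R.point p.1.1 - o) = (1 : ℝ) := h1
  change inner ℝ (planeCoeff o (R.plane p.1.2)) (R.point p.1.1 - o) - (1 : ℝ) = 0
  rw [h1, sub_self]

/-- The realization with given coordinates, with respect to the origin `o`. -/
noncomputable def Realization.ofCoords (o : E3) (x : Coord V F) (hx : ∀ f, x.2 f ≠ 0)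
    (hphi : phi I x = 0) : Realization I where
  point v := x.1 v + o
  plane f := Plane.ofEquation ⟨(x.2 f, 1 + inner ℝ (x.2 f) o), hx f⟩
  incident v f h := by
    have h1 : inner ℝ (x.2 f) (x.1 v) - 1 = (0 : ℝ) := congrFun hphi ⟨(v, f), h⟩
    change inner ℝ (x.2 f) (x.1 v + o) = 1 + (inner ℝ (x.2 f) o : ℝ)
    rw [inner_add_right, sub_eq_zero.1 h1]

lemma carrier_plane_ofCoords {o : E3} {x : Coord V F} (hx : ∀ f, x.2 f ≠ 0) (hphi : phi I x = 0)
    (f : F) : ((Realization.ofCoords o x hx hphi).plane f).carrier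
      = {z | inner ℝ (x.2 f) (z - o) = (1 : ℝ)} := by
  ext z
  change inner ℝ (x.2 f) z = 1 + (inner ℝ (x.2 f) o : ℝ) ↔ inner ℝ (x.2 f) (z - o) = (1 : ℝ)
  rw [inner_sub_right, sub_eq_iff_eq_add]

lemma notMem_plane_ofCoords {o : E3} {x : Coord V F} (hx : ∀ f, x.2 f ≠ 0) (hphi : phi I x = 0)
    (f : F) : o ∉ ((Realization.ofCoords o x hx hphi).plane f).carrier := by
  rw [carrier_plane_ofCoords, Set.mem_ofPred_eq, sub_self, inner_zero_right]
  exact zero_ne_one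

lemma coords_ofCoords {o : E3} {x : Coord V F} (hx : ∀ f, x.2 f ≠ 0) (hphi : phi I x = 0) :
    coords o (Realization.ofCoords o x hx hphi) = x := by
  refine Prod.ext (funext fun v => add_sub_cancel_right _ _) (funext fun f => ?_)
  exact planeCoeff_eq (hx f) (carrier_plane_ofCoords hx hphi f)

lemma ofCoords_coords {o : E3} {R : Realization I} (h : ∀ f, o ∉ (R.plane f).carrier)
    (hx : ∀ f, (coords o R).2 f ≠ 0) (hphi : phi I (coords o R) = 0) :
    Realization.ofCoords o (coords o R) hx hphi = R := by
  have hpt : (Realization.ofCoords o (coords o R) hx hphi).point = R.point :=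
    funext fun v => sub_add_cancel _ _
  have hpl : (Realization.ofCoords o (coords o R) hx hphi).plane = R.plane := by
    funext f
    apply Plane.ext
    rw [carrier_plane_ofCoords]
    exact (carrier_eq_planeCoeff (h f)).symm
  generalize Realization.ofCoords o (coords o R) hx hphi = R' at hpt hpl
  cases R
  cases R'
  obtain rfl : _ = _ := hpt
  obtain rfl : _ = _ := hpl
  rfl

lemma continuous_ofCoords {Y : Type*} [TopologicalSpace Y] {o : E3} {x : Y → Coord V F}
    (hc : Continuous x) (hx : ∀ y f, (x y).2 f ≠ 0) (hphi : ∀ y, phi I (x y) = 0) :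
    Continuous fun y => Realization.ofCoords o (x y) (hx y) (hphi y) := by
  refine continuous_induced_rng.2 (Continuous.prodMk (continuous_pi fun v => ?_)
    (continuous_pi fun f => ?_))
  · exact ((continuous_apply v).comp (continuous_fst.comp hc)).add continuous_const
  · have h2 : Continuous fun y => (x y).2 f := (continuous_apply f).comp (continuous_snd.comp hc)
    exact isQuotientMap_ofEquation.continuous.comp
      (Continuous.subtype_mk (h2.prodMk (continuous_const.add (h2.inner continuous_const)))
        fun y => hx y f)

/-- Near a realization at which the equations `φ = 0` are independent, the coordinates identify the
space of realizations with the zero set of `φ`, and a straightening chart for `φ` gives a chart. -/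
lemma isSmoothManifoldNear_of_surjective [Fintype V] [Fintype F] {o : E3} {Q : Realization I}
    {d : ℕ} (hQ : ∀ f, o ∉ (Q.plane f).carrier)
    (hsurj : Function.Surjective (fderiv ℝ (phi I) (coords o Q)))
    (hd : 3 * Fintype.card V + 3 * Fintype.card F = Nat.card (Incidence I) + d) :
    IsSmoothManifoldNear o Q d := by
  classical
  have : Fintype (Incidence I) := Fintype.ofFinite _
  have hO : IsOpen {x : Coord V F | ∀ f, x.2 f ≠ 0} := by
    simp only [Set.ofPred_forall]
    exact isOpen_iInter_of_finite fun f =>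
      isOpen_ne_fun ((continuous_apply f).comp continuous_snd) continuous_const
  obtain ⟨Ψ, π, hQΨ, hΨO, hΨ, hsmooth⟩ := exists_straightening (Z := EuclideanSpace ℝ (Fin d))
    (contDiff_phi I) hsurj (by
      rw [Nat.card_eq_fintype_card] at hd
      rw [Module.finrank_prod, Module.finrank_pi_fintype, Module.finrank_pi_fintype]
      simp only [Finset.sum_const, Finset.card_univ, smul_eq_mul,
        Module.finrank_fintype_fun_eq_card, finrank_euclideanSpace, Fintype.card_fin]
      omega) hO (fun f => planeCoeff_ne_zero (hQ f))
  have hΨs : ∀ y ∈ {y | ((0 : Incidence I → ℝ), y) ∈ Ψ.target},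
      phi I (Ψ.symm (0, y)) = 0 ∧ π (Ψ.symm (0, y)) = y := fun y hy => by
    have h1 := Ψ.right_inv hy
    rw [hΨ] at h1
    exact Prod.mk.inj h1
  have hmem : ∀ y ∈ {y | ((0 : Incidence I → ℝ), y) ∈ Ψ.target}, Ψ.symm (0, y) ∈ Ψ.source :=
    fun y hy => Ψ.map_target hy
  set s : Set (Realization I) := {R | (∀ f, o ∉ (R.plane f).carrier)} ∩ coords o ⁻¹' Ψ.source
    with hs
  set t : Set (EuclideanSpace ℝ (Fin d)) := {y | ((0 : Incidence I → ℝ), y) ∈ Ψ.target} with ht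
  have hcont0 : Continuous fun y : EuclideanSpace ℝ (Fin d) => ((0 : Incidence I → ℝ), y) := by
    fun_prop
  have hto : IsOpen t := Ψ.open_target.preimage hcont0
  let inv : EuclideanSpace ℝ (Fin d) → Realization I := fun y =>
    if hy : y ∈ t then Realization.ofCoords o (Ψ.symm (0, y)) (hΨO (hmem y hy)) (hΨs y hy).1 else Q
  have hinv : ∀ y (hy : y ∈ t), inv y =
      Realization.ofCoords o (Ψ.symm (0, y)) (hΨO (hmem y hy)) (hΨs y hy).1 :=
    fun y hy => dif_pos hy
  have hcinv : ∀ y ∈ t, coords o (inv y) = Ψ.symm (0, y) := fun y hy => by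
    rw [hinv y hy, coords_ofCoords]
  have hfwd : ∀ R ∈ s, ((0 : Incidence I → ℝ), π (coords o R)) = Ψ (coords o R) := fun R hR => by
    rw [hΨ, phi_coords hR.1]
  let e : OpenPartialHomeomorph (Realization I) (EuclideanSpace ℝ (Fin d)) :=
    { toFun := fun R => π (coords o R)
      invFun := inv
      source := s
      target := t
      map_source' := fun R hR => by
        change (_, _) ∈ Ψ.target
        rw [hfwd R hR]
        exact Ψ.map_source hR.2
      map_target' := fun y hy => by
        refine ⟨?_, ?_⟩
        · rw [hinv y hy]
          exact notMem_plane_ofCoords _ _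
        · rw [Set.mem_preimage, hcinv y hy]
          exact hmem y hy
      left_inv' := fun R hR => by
        have h1 : π (coords o R) ∈ t := by
          change (_, _) ∈ Ψ.target
          rw [hfwd R hR]
          exact Ψ.map_source hR.2
        rw [hinv _ h1]
        simp only [hfwd R hR, Ψ.left_inv hR.2]
        exact ofCoords_coords hR.1 _ _
      right_inv' := fun y hy => by
        rw [hcinv y hy]
        exact (hΨs y hy).2
      continuousOn_toFun :=
        π.continuous.comp_continuousOn ((continuousOn_coords o).mono Set.inter_subset_left)
      continuousOn_invFun := by
        rw [continuousOn_iff_continuous_domRestrict]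
        have h1 : Continuous fun y : t => Ψ.symm ((0 : Incidence I → ℝ), y.1) :=
          Ψ.symm.continuousOn.comp_continuous (hcont0.comp continuous_subtype_val) fun y => y.2
        refine (continuous_ofCoords (o := o) h1 (fun y => hΨO (hmem y.1 y.2))
          fun y => (hΨs y.1 y.2).1).congr fun y => (hinv y.1 y.2).symm
      open_source := (continuousOn_coords o).isOpen_inter_preimage (isOpen_avoiding o)
        Ψ.open_source
      open_target := hto }
  have hsm : ContDiffOn ℝ ∞ (fun y => coords o (e.symm y)) t := by
    refine ContDiffOn.congr (f := fun y => Ψ.symm ((0 : Incidence I → ℝ), y)) ?_ hcinv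
    exact hsmooth.comp (contDiff_const.prodMk contDiff_id).contDiffOn fun y hy => hy
  refine ⟨e, ⟨hQ, hQΨ⟩, fun R hR => hR.1, ?_, ⟨Ψ.source, Ψ.open_source, ?_⟩, hsm, fun y hy => ?_⟩
  · exact IsEmbedding.of_comp
      (continuousOn_iff_continuous_domRestrict.1
        ((continuousOn_coords o).mono Set.inter_subset_left))
      π.continuous e.isOpenEmbedding_restrict.isEmbedding
  · ext x
    constructor
    · rintro ⟨R, hR, rfl⟩
      exact ⟨hR.2, phi_coords hR.1⟩
    · rintro ⟨hx, hphi⟩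
      have hc := coords_ofCoords (o := o) (hΨO hx) hphi
      exact ⟨_, ⟨notMem_plane_ofCoords (hΨO hx) hphi, by rw [Set.mem_preimage, hc]; exact hx⟩, hc⟩
  · -- The linear map `π` is a left inverse of the parametrization.
    have hdiff : DifferentiableAt ℝ (fun y => coords o (e.symm y)) y :=
      (hsm.contDiffAt (hto.mem_nhds hy)).differentiableAt (by simp)
    have h1 : HasFDerivAt (fun y => π (coords o (e.symm y)))
        (π.comp (fderiv ℝ (fun y => coords o (e.symm y)) y)) y :=
      π.hasFDerivAt.comp y hdiff.hasFDerivAt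
    have h2 : (fun y => π (coords o (e.symm y))) =ᶠ[𝓝 y] id := by
      filter_upwards [hto.mem_nhds hy] with z hz
      exact e.right_inv hz
    have h3 := (h1.congr_of_eventuallyEq h2.symm).unique (hasFDerivAt_id y)
    exact Function.LeftInverse.injective (g := π) fun u => congrArg (fun l => l u) h3

end Realizations

end ConvexPoly

open ConvexPoly
theorem lemma2p5 (P : Set E3) (hP : IsConvexPolyhedron P) :
    ((vertices P).Finite ∧ (edges P).Finite ∧ (faces P).Finite) ∧
    (∃ n : Fin ((vertices P).ncard + (faces P).ncard) ≃ (vertices P) ⊕ (faces P),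
      ∀ i, {j | j < i ∧ (leviGraph (Incident P)).Adj (n j) (n i)}.ncard ≤ 3) ∧
    Nat.card (Incidence (Incident P)) = 2 * (edges P).ncard ∧
    3 * (vertices P).ncard + 3 * (faces P).ncard
      = 2 * (edges P).ncard + ((edges P).ncard + 6) ∧
    ∀ [Fintype (vertices P)] [Fintype (faces P)] (o : E3),
      (∀ f, o ∉ (facePlane P f).carrier) →
      LinearIndependent ℝ (fun p : Incidence (Incident P) =>
        fderiv ℝ (fun x => phi (Incident P) x p) (coords o (selfRealization P))) ∧
      Module.finrank ℝ (LinearMap.range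
        (fderiv ℝ (phi (Incident P)) (coords o (selfRealization P))).toLinearMap)
          = 2 * (edges P).ncard ∧
      IsSmoothManifoldNear o (selfRealization P) ((edges P).ncard + 6) := by
  obtain ⟨ι, _, S, rfl, hS, p, hp, hp0⟩ := hP.exists_system
  obtain ⟨s⟩ := HalfSpaceSystem.nonempty_sweep hS hp hp0
  have hVfin := HalfSpaceSystem.finite_vertices_carrier hp hp0
  have hFfin := HalfSpaceSystem.finite_faces_carrier hp hp0
  have hI := HalfSpaceSystem.card_incidence_carrier hS hp hp0
  have hcount : 3 * (vertices S.carrier).ncard + 3 * (faces S.carrier).ncard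
      = 2 * (edges S.carrier).ncard + ((edges S.carrier).ncard + 6) := by
    have : Fintype (vertices S.carrier) := hVfin.fintype
    have : Fintype (faces S.carrier) := hFfin.fintype
    have h : Nat.card (Incidence (Incident S.carrier)) + 4 = _ := s.card_incidence
    rw [hI, ← Nat.card_eq_fintype_card, ← Nat.card_eq_fintype_card, Nat.card_coe_set_eq,
      Nat.card_coe_set_eq] at h
    omega
  refine ⟨⟨hVfin, HalfSpaceSystem.finite_edges_carrier hp hp0, hFfin⟩, ?_, hI, hcount, ?_⟩
  · have : Fintype (vertices S.carrier) := hVfin.fintype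
    have : Fintype (faces S.carrier) := hFfin.fintype
    refine exists_order_of_degenerate _ ?_ s.exists_degree_le_three
    rw [Fintype.card_sum, ← Nat.card_eq_fintype_card, ← Nat.card_eq_fintype_card,
      Nat.card_coe_set_eq, Nat.card_coe_set_eq]
  · intro _ _ o ho
    have hind := linearIndependent_fderiv s.exists_degree_le_three
      (x := coords o (selfRealization S.carrier))
      (fun f T hT hTf c hc => HalfSpaceSystem.vertices_independent hp hp0 (ho f) hT hTf hc)
      (fun v T hT hTv c hc => HalfSpaceSystem.faces_independent hp hp0 ho hT hTv hc)
    have hsurj := surjective_fderiv_phi hind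
    refine ⟨hind, ?_, isSmoothManifoldNear_of_surjective ho hsurj ?_⟩
    · have : Fintype (Incidence (Incident S.carrier)) := Fintype.ofFinite _
      rw [LinearMap.range_eq_top.2 hsurj, finrank_top, Module.finrank_fintype_fun_eq_card,
        ← Nat.card_eq_fintype_card, hI]
    · rw [hI, ← Nat.card_eq_fintype_card, ← Nat.card_eq_fintype_card, Nat.card_coe_set_eq,
        Nat.card_coe_set_eq, hcount]
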